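/- Setting. Let $(X,\omega)$ be a Veech surface: a compact connected translation surface (finitely many cone points of angle $2\pi m$, $m\ge 1$; marked points $m=1$ are allowed) whose Veech group $\Gamma=\mathrm{SL}(X,\omega)\le \mathrm{SL}_2(\mathbb R)$ is a lattice. Let $H$ be a maximal parabolic subgroup of $\Gamma$. If $-\mathrm{Id}\in\Gamma$, let $P$ be a generator with eigenvalue $1$ of the infinite cyclic factor of $H\cong\mathbb Z\oplus\mathbb Z/2$; otherwise let $P$ be a generator of $H\cong\mathbb Z$. Let $w$ be a shortest holonomy vector in the eigenspace of $P$, and let $C\in \mathrm{SL}_2(\mathbb R)$ and $\alpha>0$ be such that $Cw=(1,0)$ and $CPC^{-1}=\begin{pmatrix}1&\alpha\\0&1\end{pmatrix}$ (then put $n=1$) or $CPC^{-1}=\begin{pmatrix}-1&\alpha\\0&-1\end{pmatrix}$ (then put $n=2$). Let $\Lambda\subset\mathbb R^2$ be the set of holonomy vectors of oriented saddle connections of $C\cdot(X,\omega)$. Let $(x_0,y_0)\in\Lambda$ be the vector for which $y_0>0$ is the least positive $y$-component in $\Lambda$ and $x_0>0$ is the least positive $x$-component among the vectors of $\Lambda$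 with $y$-component $y_0$. Put $$\Omega=\Big\{(a,b)\in\mathbb R^2 : 0<b\le 1,\ \tfrac{x_0}{y_0}b-\tfrac1{y_0}\le a<\big(\tfrac{x_0}{y_0}+n\alpha\big)b-\tfrac1{y_0}\Big\},\qquad A^L=\Big(\tfrac{x_0-1}{y_0},\ \tfrac{x_0-1}{y_0}+n\alpha\Big].$$ Winners. A vector $(x,y)\in\Lambda$ is a candidate at $(a,b)\in\Omega$ if $y>0$ and $0<bx-ay\le 1$. The winning vector at $(a,b)$ is the candidate $v$ for which $\begin{pmatrix}b&-a\\0&1/b\end{pmatrix}v$ has least slope, and the shortest such one if there are several. A vector $(x,y)\in\Lambda$ is a left candidate at $a\in A^L$ if $y>0$ and $0\le x-ay<1$. The left winning vector at $a$ is the left candidate of least slope, and the shortest such one if there are several; here an undefined slope counts as larger than every positive and smaller than every negative slope, so that least slope means largest $x/y$. Let $W^L(v)\subseteq A^L$ be the set of points at which $v$ is the left winning vector. Algorithm. Start with $i=1$ and $a_1=\frac{x_0-1}{y_0}+n\alpha$. In round $i$, find the left winning vector $(u_i,v_i)$ at $a_i$ and set $a_{i+1}=\frac{u_i-1}{v_i}$.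 If $(u_i,v_i)=(x_0,y_0)$, end; otherwise go on to round $i+1$. Theorem. Suppose that at every point $a_i$ that the algorithm reaches one can find the left winning vector (that is, a subroutine is given that returns it whenever it exists). Then the algorithm terminates, say in round $N$. Every $a_i$ with $1\le i\le N$ lies in $A^L$ and $(u_i,v_i)$ is the left winning vector at $a_i$. Moreover $$\{(u_i,v_i): 1\le i\le N\}=\{v\in\Lambda : v \text{ is the winning vector at some point of } \Omega\},$$ and $W^L(u_i,v_i)=(a_{i+1},a_i]$ for every $1\le i\le N$. -/

import Mathlib

open Set Filter Topology
open scoped MatrixGroups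

namespace Slopes

/-- The linear action of a real `2 × 2` matrix on the plane `ℂ = ℝ²`. -/
def planeMap (A : Matrix (Fin 2) (Fin 2) ℝ) (z : ℂ) : ℂ :=
  ⟨A 0 0 * z.re + A 0 1 * z.im, A 1 0 * z.re + A 1 1 * z.im⟩

/-- A translation structure on `X` (meant for compact connected Hausdorff `X`): a finite set `sing`
of singular (or marked) points and, away from it, an atlas of natural charts, in which the one-form
`ω` is `dz`, whose changes of coordinates are locally translations. Near a singular point there is a
coordinate `φ` centred there with `ω = d (φ ^ m)`, that is, a cone point of angle `2 π m`,
a zero of `ω` of order `m - 1` (a marked regular point if `m = 1`). -/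
structure TranslationSurface (X : Type*) [TopologicalSpace X] where
  sing : Set X
  charts : Set (OpenPartialHomeomorph X ℂ)
  finite_sing : sing.Finite
  disjoint_sing : ∀ c ∈ charts, Disjoint c.source sing
  cover : ∀ p ∉ sing, ∃ c ∈ charts, p ∈ c.source
  translation : ∀ c ∈ charts, ∀ c' ∈ charts, ∀ p ∈ c.source ∩ c'.source,
    ∀ᶠ q in 𝓝 p, c' q - c' p = c q - c p
  cone : ∀ p ∈ sing, ∃ m : ℕ, 1 ≤ m ∧ ∃ φ : OpenPartialHomeomorph X ℂ,
    p ∈ φ.source ∧ φ p = 0 ∧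
      ∀ c ∈ charts, ∀ q ∈ c.source ∩ φ.source, ∀ᶠ r in 𝓝 q, c r - c q = φ r ^ m - φ q ^ m

namespace TranslationSurface

variable {X : Type*} [TopologicalSpace X]

/-- `γ`, restricted to `[0, 1]`, is an oriented saddle connection parametrized with constant
velocity `v`: a straight segment that joins two singular points and has none in its interior.
As `ω` is `dz` in the charts, `v = ∫_γ ω`. -/
structure IsSaddleConnection (S : TranslationSurface X) (γ : ℝ → X) (v : ℂ) : Prop where
  continuousOn : ContinuousOn γ (Icc 0 1)
  start : γ 0 ∈ S.sing
  finish : γ 1 ∈ S.sing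
  interior : ∀ t ∈ Ioo (0 : ℝ) 1, γ t ∉ S.sing
  straight : ∀ t ∈ Ioo (0 : ℝ) 1, ∀ c ∈ S.charts, γ t ∈ c.source →
    ∀ᶠ s in 𝓝 t, c (γ s) - c (γ t) = ((s - t : ℝ) : ℂ) * v

/-- The set `Λ` of holonomy vectors of all oriented saddle connections. -/
def holonomy (S : TranslationSurface X) : Set ℂ :=
  {v | ∃ γ : ℝ → X, S.IsSaddleConnection γ v}

/-- `f` is an affine self-homeomorphism of the surface with linear part `A`. -/
structure IsAffine (S : TranslationSurface X) (f : X ≃ₜ X) (A : SL(2, ℝ)) : Prop where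
  sing_iff : ∀ p, f p ∈ S.sing ↔ p ∈ S.sing
  linear : ∀ c ∈ S.charts, ∀ c' ∈ S.charts, ∀ p ∈ c.source, f p ∈ c'.source →
    ∀ᶠ q in 𝓝 p, c' (f q) - c' (f p) = planeMap A (c q - c p)

end TranslationSurface

lemma planeMap_one (z : ℂ) : planeMap ((1 : SL(2, ℝ)) : Matrix (Fin 2) (Fin 2) ℝ) z = z := by
  apply Complex.ext <;> simp [planeMap]

lemma planeMap_mul (A B : SL(2, ℝ)) (z : ℂ) :
    planeMap ((A * B : SL(2, ℝ)) : Matrix (Fin 2) (Fin 2) ℝ) z = planeMap A (planeMap B z) := by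
  apply Complex.ext <;>
    simp [planeMap, Matrix.SpecialLinearGroup.coe_mul, Matrix.mul_apply, Fin.sum_univ_two] <;> ring

namespace TranslationSurface

variable {X : Type*} [TopologicalSpace X]

lemma isAffine_one (S : TranslationSurface X) : S.IsAffine (Homeomorph.refl X) 1 where
  sing_iff _ := Iff.rfl
  linear c hc c' hc' p hp hp' := by
    filter_upwards [S.translation c hc c' hc' p ⟨hp, hp'⟩] with q hq
    rw [planeMap_one]
    exact hq

lemma IsAffine.mul {S : TranslationSurface X} {f g : X ≃ₜ X} {A B : SL(2, ℝ)}
    (hf : S.IsAffine f A) (hg : S.IsAffine g B) : S.IsAffine (g.trans f) (A * B) where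
  sing_iff p := (hf.sing_iff (g p)).trans (hg.sing_iff p)
  linear c hc c' hc' p hp hp' := by
    have hps : g p ∉ S.sing := fun h =>
      Set.disjoint_left.1 (S.disjoint_sing c hc) hp ((hg.sing_iff p).1 h)
    obtain ⟨d, hd, hdp⟩ := S.cover (g p) hps
    filter_upwards [hg.linear c hc d hd p hp hdp,
      (g.continuous.tendsto p).eventually (hf.linear d hd c' hc' (g p) hdp hp')] with q h1 h2
    rw [planeMap_mul, ← h1]
    exact h2

lemma IsAffine.inv {S : TranslationSurface X} {f : X ≃ₜ X} {A : SL(2, ℝ)}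
    (hf : S.IsAffine f A) : S.IsAffine f.symm A⁻¹ where
  sing_iff p := by simpa using (hf.sing_iff (f.symm p)).symm
  linear c hc c' hc' p hp hp' := by
    have h := hf.linear c' hc' c hc (f.symm p) hp' (by simpa using hp)
    filter_upwards [(f.symm.continuous.tendsto p).eventually h] with q hq
    simp only [Homeomorph.apply_symm_apply] at hq
    rw [hq, ← planeMap_mul, inv_mul_cancel, planeMap_one]

/-- The Veech group `SL(X, ω)`. -/
def veechGroup (S : TranslationSurface X) : Subgroup SL(2, ℝ) where
  carrier := {A | ∃ f : X ≃ₜ X, S.IsAffine f A}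
  one_mem' := ⟨_, S.isAffine_one⟩
  mul_mem' := by
    rintro A B ⟨f, hf⟩ ⟨g, hg⟩
    exact ⟨_, hf.mul hg⟩
  inv_mem' := by
    rintro A ⟨f, hf⟩
    exact ⟨_, hf.inv⟩

end TranslationSurface

/-- A lattice in `SL(2, ℝ)`: a discrete subgroup with a measurable set of finite Haar measure
that meets every coset. -/
def IsLatticeSL2 (Γ : Subgroup SL(2, ℝ)) : Prop :=
  DiscreteTopology Γ ∧
    letI : MeasurableSpace SL(2, ℝ) := borel _
    ∃ μ : MeasureTheory.Measure SL(2, ℝ), μ.IsHaarMeasure ∧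
      ∃ F : Set SL(2, ℝ), MeasurableSet F ∧ μ F < ⊤ ∧ ∀ g : SL(2, ℝ), ∃ h ∈ Γ, h * g ∈ F

/-- `(X, ω)` is a Veech surface: its Veech group is a lattice. -/
def TranslationSurface.IsVeech {X : Type*} [TopologicalSpace X] (S : TranslationSurface X) : Prop :=
  IsLatticeSL2 S.veechGroup

/-- A parabolic subgroup: it contains a parabolic element and, up to `± 1`, nothing else. -/
def IsParabolicSubgroup (H : Subgroup SL(2, ℝ)) : Prop :=
  (∃ g ∈ H, (g : Matrix (Fin 2) (Fin 2) ℝ).IsParabolic) ∧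
    ∀ g ∈ H, (g : Matrix (Fin 2) (Fin 2) ℝ).IsParabolic ∨ g = 1 ∨ g = -1

/-- A maximal parabolic subgroup of `Γ` (these represent the cusps of `Γ`). -/
def IsMaximalParabolicSubgroup (Γ H : Subgroup SL(2, ℝ)) : Prop :=
  Maximal (fun K : Subgroup SL(2, ℝ) => K ≤ Γ ∧ IsParabolicSubgroup K) H

/-- `P` is the chosen generator of the maximal parabolic subgroup `H` of `Γ`: if `-1 ∈ Γ`, it
generates the infinite cyclic factor of `H ≅ ℤ ⊕ ℤ/2` and has eigenvalue `1`; otherwise it generates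
`H ≅ ℤ`. -/
def IsParabolicGenerator (Γ H : Subgroup SL(2, ℝ)) (P : SL(2, ℝ)) : Prop :=
  (-1 ∈ Γ ∧ H = Subgroup.closure {P, -1} ∧ (P : Matrix (Fin 2) (Fin 2) ℝ).trace = 2) ∨
    (-1 ∉ Γ ∧ H = Subgroup.zpowers P)

/-- The normalization of a Veech surface at a cusp. The cusp is the maximal parabolic subgroup `H`
with generator `P`; `w` is a shortest holonomy vector in the eigenspace of `P`; and `C` sends `w` to
`(1, 0)` and conjugates `P` to an upper triangular matrix with off-diagonal entry `α > 0`. Here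
`n = 1` or `n = 2` according to whether the eigenvalue of `P` is `1` or `-1`. -/
structure IsCuspNormalization {X : Type*} [TopologicalSpace X] (S : TranslationSurface X)
    (H : Subgroup SL(2, ℝ)) (P C : SL(2, ℝ)) (w : ℂ) (α : ℝ) (n : ℕ) : Prop where
  maximal : IsMaximalParabolicSubgroup S.veechGroup H
  generator : IsParabolicGenerator S.veechGroup H P
  pos : 0 < α
  conj :
    (n = 1 ∧ ((C * P * C⁻¹ : SL(2, ℝ)) : Matrix (Fin 2) (Fin 2) ℝ) = !![1, α; 0, 1]) ∨
    (n = 2 ∧ ((C * P * C⁻¹ : SL(2, ℝ)) : Matrix (Fin 2) (Fin 2) ℝ) = !![-1, α; 0, -1])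
  mem : w ∈ S.holonomy
  eigen : ∃ r : ℝ, planeMap P w = r • w
  shortest : ∀ v ∈ S.holonomy, (∃ r : ℝ, planeMap P v = r • v) → ‖w‖ ≤ ‖v‖
  normalized : planeMap C w = 1

/-- `z₀ = (x₀, y₀) ∈ Λ` has the least positive `y`-component in `Λ`, and among the vectors of `Λ`
with that `y`-component it has the least positive `x`-component. -/
def IsBaseVector (Λ : Set ℂ) (z₀ : ℂ) : Prop :=
  z₀ ∈ Λ ∧ IsLeast {y : ℝ | 0 < y ∧ ∃ v ∈ Λ, v.im = y} z₀.im ∧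
    IsLeast {x : ℝ | 0 < x ∧ ∃ v ∈ Λ, v.im = z₀.im ∧ v.re = x} z₀.re

/-- The transversal `Ω`, a triangle in the `(a, b)`-plane. -/
def transversal (z₀ : ℂ) (n : ℕ) (α : ℝ) : Set (ℝ × ℝ) :=
  {p | 0 < p.2 ∧ p.2 ≤ 1 ∧ z₀.re / z₀.im * p.2 - 1 / z₀.im ≤ p.1 ∧
    p.1 < (z₀.re / z₀.im + n * α) * p.2 - 1 / z₀.im}

/-- The matrix `M_{b,-a}`; the point `(a, b)` of the transversal stands for the surface
`M_{b,-a} C · (X, ω)`. -/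
noncomputable def pointMatrix (p : ℝ × ℝ) : Matrix (Fin 2) (Fin 2) ℝ :=
  !![p.2, -p.1; 0, 1 / p.2]

/-- The slope of a vector (with nonzero `x`-component). -/
noncomputable def slope (z : ℂ) : ℝ := z.im / z.re

/-- `v ∈ Λ` is a candidate winning vector at `(a, b)`: `M_{b,-a} v` has positive `y`-component and
its `x`-component `b x - a y` lies in `(0, 1]`. -/
def IsCandidate (Λ : Set ℂ) (p : ℝ × ℝ) (v : ℂ) : Prop :=
  v ∈ Λ ∧ 0 < v.im ∧ 0 < p.2 * v.re - p.1 * v.im ∧ p.2 * v.re - p.1 * v.im ≤ 1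

/-- `v` is the winning vector at `(a, b)`: of all candidates, `M_{b,-a} v` has the least slope, and
it is the shortest one of that slope. -/
def IsWinner (Λ : Set ℂ) (p : ℝ × ℝ) (v : ℂ) : Prop :=
  IsCandidate Λ p v ∧ ∀ u, IsCandidate Λ p u →
    slope (planeMap (pointMatrix p) v) < slope (planeMap (pointMatrix p) u) ∨
    (slope (planeMap (pointMatrix p) v) = slope (planeMap (pointMatrix p) u) ∧
      ‖planeMap (pointMatrix p) v‖ ≤ ‖planeMap (pointMatrix p) u‖)

/-- The set of winning vectors on the transversal `Ω`. -/
def winners (Λ : Set ℂ) (z₀ : ℂ) (n : ℕ) (α : ℝ) : Set ℂ :=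
  {v | ∃ p ∈ transversal z₀ n α, IsWinner Λ p v}

/-- The right endpoint of `A^L`. -/
noncomputable def rightEnd (z₀ : ℂ) (n : ℕ) (α : ℝ) : ℝ := (z₀.re - 1) / z₀.im + n * α

/-- The interval `A^L`, the top edge `b = 1` with its right endpoint instead of its left one. -/
def topEdgeL (z₀ : ℂ) (n : ℕ) (α : ℝ) : Set ℝ :=
  Ioc ((z₀.re - 1) / z₀.im) (rightEnd z₀ n α)

/-- `v ∈ Λ` is a candidate left winning vector at `(a, b)`. -/
def IsLeftCandidate (Λ : Set ℂ) (p : ℝ × ℝ) (v : ℂ) : Prop :=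
  v ∈ Λ ∧ 0 < v.im ∧ 0 ≤ p.2 * v.re - p.1 * v.im ∧ p.2 * v.re - p.1 * v.im < 1

/-- `v` is the left winning vector at `(a, b)`: the left candidate of least slope, and the shortest
one of that slope. An undefined slope counts as larger than every positive and smaller than every
negative slope, so for vectors with positive `y`-component smaller slope means larger `x / y`. -/
def IsLeftWinner (Λ : Set ℂ) (p : ℝ × ℝ) (v : ℂ) : Prop :=
  IsLeftCandidate Λ p v ∧ ∀ u, IsLeftCandidate Λ p u →
    u.re / u.im < v.re / v.im ∨ (u.re / u.im = v.re / v.im ∧ ‖v‖ ≤ ‖u‖)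

/-- `W^L(v)`, the part of `A^L` on which `v` is the left winning vector. -/
def leftWinSet (Λ : Set ℂ) (z₀ : ℂ) (n : ℕ) (α : ℝ) (v : ℂ) : Set ℝ :=
  {a | a ∈ topEdgeL z₀ n α ∧ IsLeftWinner Λ (a, 1) v}

/-- The points `a_i` that the algorithm visits, counted from `i = 0`. The function `find` is the
subroutine that is asked for the left winning vector at a point, so `(u_i, v_i) = find a_i`; the next
point is `(u_i - 1) / v_i`. (The algorithm ends as soon as `find a_i = z₀`; later values are not
part of its run.) -/
noncomputable def algPoint (find : ℝ → ℂ) (start : ℝ) : ℕ → ℝ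
  | 0 => start
  | i + 1 => ((find (algPoint find start i)).re - 1) / (find (algPoint find start i)).im

/-- The vector `(u_i, v_i)` that the algorithm produces in round `i`. -/
noncomputable def algVector (find : ℝ → ℂ) (start : ℝ) (i : ℕ) : ℂ :=
  find (algPoint find start i)

/-- Round `i` is reached: the algorithm did not end in an earlier round. -/
def Reached (find : ℝ → ℂ) (start : ℝ) (z₀ : ℂ) (i : ℕ) : Prop :=
  ∀ j < i, algVector find start j ≠ z₀

/-- The algorithm ends in round `N`. -/
def EndsAt (find : ℝ → ℂ) (start : ℝ) (z₀ : ℂ) (N : ℕ) : Prop :=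
  Reached find start z₀ N ∧ algVector find start N = z₀

end Slopes

/-! On the line b = 1 a vector (x, y) with y > 0 is a left candidate exactly for a in ((x - 1)/y,
x/y], and the winner is the best candidate in an order independent of a: larger x/y first, then
smaller y (`IsBest`). When the point moves left from a, every newly admitted vector has ratio x/y
less than a, while the present winner has ratio at least a. So a winner (u, v) keeps winning until
it stops being a candidate at (u - 1)/v (`best_left_mono`), the point to which the algorithm jumps.

Since y₀ is the least positive height, no winner's interval reaches beyond the left end of A^L, and
only that of z₀ reaches it (`left_end_le`). If the algorithm did not stop, the points would decrease
to a limit l. The ordinary winner at l is the left winner just to the right of l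
(`best_right_to_left`), so it would be found in some round and the next point would be at most l, a
contradiction. Winners at general points of Ω are carried to the top edge by sliding along their own
direction (`best_top`), so `mem_winners_iff` identifies them with the left winners on A^L.

This order argument needs two geometric facts about Λ. It is locally finite (`finite_holonomy`): by
compactness, the itinerary of a straight path of bounded length through finitely many charts
determines its vector. And candidates exist at every a (`exists_holonomy_in_strip`): the exponential
map is developed over a half-infinite strip above a saddle connection. The lowest singular point met
inside the strip yields a saddle connection. If none is met, recurrence places singular points on
both sides of the strip, and tilting the strip slightly brings one of them inside. -/

namespace Slopes

/-! ### Developing maps and their uniqueness. -/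

namespace TranslationSurface

variable {X : Type*} [TopologicalSpace X]

/-- `g : E → X` avoids the singular set at `z` and is given near `z`, in natural charts and up to
translation, by the function `D : E → ℂ`. -/
structure DevAt {E : Type*} [TopologicalSpace E] (S : TranslationSurface X) (D : E → ℂ)
    (g : E → X) (z : E) : Prop where
  continuousAt : ContinuousAt g z
  regular : g z ∉ S.sing
  dev : ∀ c ∈ S.charts, g z ∈ c.source → ∀ᶠ z' in 𝓝 z, c (g z') - c (g z) = D z' - D z

section DevAt

variable {E E' : Type*} [TopologicalSpace E] [TopologicalSpace E'] {S : TranslationSurface X}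

lemma DevAt.comp {D : E → ℂ} {g : E → X} {k : E' → E} {y : E'} (h : S.DevAt D g (k y))
    (hk : ContinuousAt k y) : S.DevAt (D ∘ k) (g ∘ k) y where
  continuousAt := ContinuousAt.comp h.continuousAt hk
  regular := h.regular
  dev c hc hy := hk.eventually (h.dev c hc hy)

lemma DevAt.congr_dev {D D' : E → ℂ} {g : E → X} {z : E} (h : S.DevAt D g z)
    (hD : ∀ z', D' z' - D' z = D z' - D z) : S.DevAt D' g z where
  continuousAt := h.continuousAt
  regular := h.regular
  dev c hc hy := by
    filter_upwards [h.dev c hc hy] with z' hz'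
    rw [hz', hD]

lemma DevAt.congr {D : E → ℂ} {g g' : E → X} {z : E} (h : S.DevAt D g z)
    (hg : g' =ᶠ[𝓝 z] g) : S.DevAt D g' z where
  continuousAt := h.continuousAt.congr hg.symm
  regular := by rw [hg.eq_of_nhds]; exact h.regular
  dev c hc hy := by
    rw [hg.eq_of_nhds] at hy
    filter_upwards [h.dev c hc hy, hg] with z' hz' h'
    rw [h', hg.eq_of_nhds, hz']

/-- In a chart at the common value both maps read as the same translate of `D`, and the chart is
injective. -/
lemma DevAt.eventuallyEq {D : E → ℂ} {g h : E → X} {z : E} (hg : S.DevAt D g z)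
    (hh : S.DevAt D h z) (e : g z = h z) : g =ᶠ[𝓝 z] h := by
  obtain ⟨c, hc, hz⟩ := S.cover _ hg.regular
  have hz' : h z ∈ c.source := e ▸ hz
  filter_upwards [hg.dev c hc hz, hh.dev c hc hz',
    hg.continuousAt.eventually (c.open_source.mem_nhds hz),
    hh.continuousAt.eventually (c.open_source.mem_nhds hz')] with y h1 h2 h3 h4
  apply c.injOn h3 h4
  rw [← h2, e] at h1
  exact sub_left_injective h1

/-- Maps with the same developing function agree on a preconnected set as soon as they agree at
one of its points. -/
lemma DevAt.eqOn [T2Space X] {D : E → ℂ} {g h : E → X} {K : Set E} (hK : IsPreconnected K)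
    (hg : ∀ z ∈ K, S.DevAt D g z) (hh : ∀ z ∈ K, S.DevAt D h z) {z₀ : E} (hz₀ : z₀ ∈ K)
    (e : g z₀ = h z₀) : EqOn g h K := by
  -- The interior of the agreement set is relatively closed in `K`: at a limit point the values
  -- agree because `X` is Hausdorff, and then they agree nearby.
  have key : K ⊆ interior {z | g z = h z} := by
    apply hK.subset_of_closure_inter_subset isOpen_interior
    · exact ⟨z₀, hz₀, mem_interior_iff_mem_nhds.2 ((hg _ hz₀).eventuallyEq (hh _ hz₀) e)⟩
    · rintro z ⟨hz, hzK⟩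
      have e' : g z = h z := by
        by_contra hne
        have : ∀ᶠ y in 𝓝 z, g y ≠ h y :=
          ((hg z hzK).continuousAt.prodMk (hh z hzK).continuousAt).eventually
            (isClosed_diagonal.isOpen_compl.mem_nhds (x := (g z, h z)) (by simpa using hne))
        obtain ⟨y, hy1, hy2⟩ := mem_closure_iff_nhds.1 hz _ this
        exact hy1 (interior_subset (s := {z | g z = h z}) hy2)
      exact mem_interior_iff_mem_nhds.2 ((hg _ hzK).eventuallyEq (hh _ hzK) e')
  exact fun z hz => interior_subset (s := {z | g z = h z}) (key hz)

end DevAt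

/-! ### Cone charts and straight paths inside them. -/

/-- A coordinate `φ` centred at `p`, with no singular points except possibly `p` and with
`ω = d (φ ^ m)`, whose image contains a disc. -/
structure ConeChart (S : TranslationSurface X) (p : X) where
  φ : OpenPartialHomeomorph X ℂ
  m : ℕ
  ρ : ℝ
  m_pos : 1 ≤ m
  ρ_pos : 0 < ρ
  mem_source : p ∈ φ.source
  center : φ p = 0
  target : ∀ w : ℂ, ‖w‖ ^ m < ρ → w ∈ φ.target
  sing : ∀ q ∈ φ.source, q ∈ S.sing → q = p
  linear : ∀ c ∈ S.charts, ∀ q ∈ c.source ∩ φ.source,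
    ∀ᶠ r in 𝓝 q, c r - c q = φ r ^ m - φ q ^ m

namespace ConeChart

variable {S : TranslationSurface X} {p : X}

/-- The other singular points form a finite, hence closed, set and can be cut out of the domain. A
disc of radius r in the target gives `ρ = r ^ m`, because `ρ` measures φ ^ m rather than φ. -/
lemma exists_of_chart [T2Space X] (φ : OpenPartialHomeomorph X ℂ) (m : ℕ) (hm : 1 ≤ m)
    (hp : p ∈ φ.source) (h0 : φ p = 0) (hl : ∀ c ∈ S.charts, ∀ q ∈ c.source ∩ φ.source,
      ∀ᶠ r in 𝓝 q, c r - c q = φ r ^ m - φ q ^ m) :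
    ∃ K : S.ConeChart p, K.m = m := by
  have hopen : IsOpen ((S.sing \ {p})ᶜ) :=
    (S.finite_sing.subset sdiff_subset).isClosed.isOpen_compl
  let ψ := φ.restrOpen _ hopen
  have hs : ψ.source = φ.source ∩ (S.sing \ {p})ᶜ := rfl
  have hps : p ∈ ψ.source := by rw [hs]; exact ⟨hp, by simp⟩
  have hψ : ∀ x, ψ x = φ x := fun _ => rfl
  have h0' : (0 : ℂ) ∈ ψ.target := by
    rw [← h0, ← hψ]; exact ψ.map_source hps
  obtain ⟨r, hr, hball⟩ := Metric.isOpen_iff.1 ψ.open_target 0 h0'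
  refine ⟨⟨ψ, m, r ^ m, hm, by positivity, hps, h0, ?_, ?_, ?_⟩, rfl⟩
  · intro w hw
    apply hball
    rw [mem_ball_zero_iff]
    exact lt_of_pow_lt_pow_left₀ m hr.le hw
  · intro q hq hqs
    rw [hs] at hq
    by_contra hne
    exact hq.2 ⟨hqs, hne⟩
  · intro c hc q hq
    exact hl c hc q ⟨hq.1, hq.2.1⟩

lemma exists_of_regular [T2Space X] (hp : p ∉ S.sing) : ∃ K : S.ConeChart p, K.m = 1 := by
  obtain ⟨c, hc, hpc⟩ := S.cover p hp
  refine exists_of_chart (c.transHomeomorph (Homeomorph.addRight (-c p))) 1 le_rfl hpc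
    (by simp) ?_
  intro d hd q hq
  filter_upwards [S.translation d hd c hc q hq] with r hr
  simp [hr]

instance [T2Space X] : Nonempty (S.ConeChart p) := by
  by_cases hp : p ∈ S.sing
  · obtain ⟨m, hm, φ, h1, h2, h3⟩ := S.cone p hp
    exact ⟨(exists_of_chart φ m hm h1 h2 h3).choose⟩
  · exact ⟨(exists_of_regular hp).choose⟩

variable (K : S.ConeChart p)

/-- The primitive `φ ^ m` of `ω`. -/
noncomputable def F (x : X) : ℂ := K.φ x ^ K.m

/-- The part of the chart domain where `|F| < r`. -/
def nhd (r : ℝ) : Set X := {x | x ∈ K.φ.source ∧ ‖K.F x‖ < r}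

lemma continuousAt_F {x : X} (hx : x ∈ K.φ.source) : ContinuousAt K.F x :=
  (K.φ.continuousAt hx).pow _

lemma F_center : K.F p = 0 := by
  have := K.m_pos
  simp [F, K.center]; omega

lemma isOpen_nhd (r : ℝ) : IsOpen (K.nhd r) := by
  have : ContinuousOn (fun x => ‖K.F x‖) K.φ.source :=
    fun x hx => (K.continuousAt_F hx).norm.continuousWithinAt
  exact this.isOpen_inter_preimage K.φ.open_source isOpen_Iio

lemma mem_nhd {r : ℝ} (hr : 0 < r) : p ∈ K.nhd r :=
  ⟨K.mem_source, by rw [F_center]; simpa⟩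

lemma nhd_mem_nhds {r : ℝ} (hr : 0 < r) : K.nhd r ∈ 𝓝 p :=
  (K.isOpen_nhd r).mem_nhds (K.mem_nhd hr)

lemma nhd_mono {r s : ℝ} (h : r ≤ s) : K.nhd r ⊆ K.nhd s := fun _ hx => ⟨hx.1, hx.2.trans_le h⟩

/-- This is the image under `φ.symm` of a compact subset of the target, hence compact. It prevents a
path from slipping out of the chart domain while |F| stays below `ρ`. -/
lemma isClosed_closedNhd [T2Space X] {r : ℝ} (hr : r < K.ρ) :
    IsClosed {x | x ∈ K.φ.source ∧ ‖K.F x‖ ≤ r} := by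
  have hsub : {w : ℂ | ‖w‖ ^ K.m ≤ r} ⊆ K.φ.target := fun w hw => K.target w (lt_of_le_of_lt hw hr)
  have hcpt : IsCompact {w : ℂ | ‖w‖ ^ K.m ≤ r} := by
    refine Metric.isCompact_of_isClosed_isBounded ?_ ?_
    · exact isClosed_le (by fun_prop) (by fun_prop)
    · refine (Metric.isBounded_closedBall (x := (0 : ℂ)) (r := max r 1)).subset ?_
      intro w hw
      rw [mem_closedBall_zero_iff]
      by_contra! h
      have h1 : 1 ≤ ‖w‖ := ((le_max_right _ _).trans_lt h).le
      have := le_self_pow₀ h1 (by have := K.m_pos; omega : K.m ≠ 0)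
      have h2 : r < ‖w‖ := (le_max_left _ _).trans_lt h
      have h3 : ‖w‖ ^ K.m ≤ r := hw
      linarith
  have : {x | x ∈ K.φ.source ∧ ‖K.F x‖ ≤ r} = K.φ.symm '' {w : ℂ | ‖w‖ ^ K.m ≤ r} := by
    ext x
    constructor
    · rintro ⟨h1, h2⟩
      exact ⟨K.φ x, by simpa [F] using h2, K.φ.left_inv h1⟩
    · rintro ⟨w, hw, rfl⟩
      refine ⟨K.φ.map_target (hsub hw), ?_⟩
      rw [F, K.φ.right_inv (hsub hw)]
      simpa using hw
  rw [this]
  exact (hcpt.image_of_continuousOn (K.φ.symm.continuousOn.mono hsub)).isClosed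

lemma tendsto_center {ι : Type*} {l : Filter ι} {g : ι → X} (hs : ∀ᶠ i in l, g i ∈ K.φ.source)
    (hF : Tendsto (fun i => K.F (g i)) l (𝓝 0)) : Tendsto g l (𝓝 p) := by
  have h1 : Tendsto (fun i => K.φ (g i)) l (𝓝 0) := by
    rw [tendsto_zero_iff_norm_tendsto_zero] at hF ⊢
    rw [Metric.tendsto_nhds] at hF ⊢
    intro ε hε
    filter_upwards [hF (ε ^ K.m) (by positivity)] with i hi
    simp only [F, norm_pow, dist_zero_right, norm_norm] at hi ⊢
    exact lt_of_pow_lt_pow_left₀ _ hε.le hi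
  have h2 : ContinuousAt K.φ.symm 0 := by
    have := K.φ.continuousAt_symm (K.φ.map_source K.mem_source)
    rwa [K.center] at this
  have h3 : K.φ.symm 0 = p := by rw [← K.center]; exact K.φ.left_inv K.mem_source
  have h4 := h2.tendsto.comp h1
  rw [h3] at h4
  refine h4.congr' ?_
  filter_upwards [hs] with i hi
  exact K.φ.left_inv hi

lemma eq_center {q : X} (hq : q ∈ K.φ.source) (h : K.F q = 0) : q = p := by
  apply K.φ.injOn hq K.mem_source
  rw [K.center]
  exact pow_eq_zero_iff (by have := K.m_pos; omega) |>.1 h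

lemma eventually_F {E : Type*} [TopologicalSpace E] {D : E → ℂ} {g : E → X} {z : E}
    (h : S.DevAt D g z) (hz : g z ∈ K.φ.source) :
    ∀ᶠ z' in 𝓝 z, K.F (g z') - K.F (g z) = D z' - D z := by
  obtain ⟨c, hc, hzc⟩ := S.cover _ h.regular
  filter_upwards [h.dev c hc hzc, h.continuousAt.eventually (K.linear c hc _ ⟨hzc, hz⟩)]
    with z' h1 h2
  rw [← h1, h2, F, F]

/-- Continuity argument from the left end: the good times form a closed set since |F| stays at most
`R < ρ`, and the developing condition extends them to the right. The start is assumed regular here;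
`straight` drops this. -/
lemma straight_aux [T2Space X] {γ : ℝ → X} {v : ℂ} {s t : ℝ}
    (hγ : ContinuousOn γ (Icc s t)) (hd : ∀ r ∈ Ico s t, S.DevAt (fun r : ℝ => (r : ℂ) * v) γ r)
    (h0 : γ s ∈ K.φ.source) (hρ : ‖K.F (γ s)‖ + (t - s) * ‖v‖ < K.ρ) :
    ∀ r ∈ Icc s t, γ r ∈ K.φ.source ∧ K.F (γ r) = K.F (γ s) + ((r - s : ℝ) : ℂ) * v := by
  set R := ‖K.F (γ s)‖ + (t - s) * ‖v‖
  set A : Set ℝ := {r | γ r ∈ K.φ.source ∧ K.F (γ r) = K.F (γ s) + ((r - s : ℝ) : ℂ) * v}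
  have hnorm : ∀ r ∈ Icc s t, r ∈ A → ‖K.F (γ r)‖ ≤ R := by
    rintro r hr ⟨-, h⟩
    rw [h]
    refine (norm_add_le _ _).trans ?_
    rw [norm_mul, Complex.norm_real, Real.norm_of_nonneg (by linarith [hr.1])]
    have := mul_le_mul_of_nonneg_right (by linarith [hr.2] : r - s ≤ t - s) (norm_nonneg v)
    simp only [R]; linarith
  have hK := K.isClosed_closedNhd hρ
  have hcl : IsClosed (A ∩ Icc s t) := by
    have h1 : IsClosed (Icc s t ∩ γ ⁻¹' {x | x ∈ K.φ.source ∧ ‖K.F x‖ ≤ R}) :=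
      hγ.preimage_isClosed_of_isClosed isClosed_Icc hK
    have h2 : ContinuousOn (fun r => K.F (γ r) - (K.F (γ s) + ((r - s : ℝ) : ℂ) * v))
        (Icc s t ∩ γ ⁻¹' {x | x ∈ K.φ.source ∧ ‖K.F x‖ ≤ R}) := by
      apply ContinuousOn.sub
      · intro r hr
        exact ContinuousAt.comp_continuousWithinAt (g := K.F) (K.continuousAt_F hr.2.1)
          ((hγ r hr.1).mono inter_subset_left)
      · fun_prop
    have h3 := h2.preimage_isClosed_of_isClosed h1 (isClosed_singleton (x := (0 : ℂ)))
    convert h3 using 1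
    ext r
    constructor
    · rintro ⟨h, hr⟩
      exact ⟨⟨hr, h.1, hnorm r hr h⟩, by simp [h.2]⟩
    · rintro ⟨⟨hr, h, -⟩, h'⟩
      exact ⟨⟨h, sub_eq_zero.1 h'⟩, hr⟩
  apply hcl.Icc_subset_of_forall_mem_nhdsWithin ⟨h0, by simp⟩
  rintro r ⟨hrA, hr⟩
  apply mem_nhdsWithin_of_mem_nhds
  filter_upwards [K.eventually_F (hd r hr) hrA.1,
    (hd r hr).continuousAt.eventually (K.φ.open_source.mem_nhds hrA.1)] with r' h1 h2
  refine ⟨h2, ?_⟩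
  rw [sub_eq_iff_eq_add.1 h1, hrA.2]
  push_cast
  ring

/-- A straight path that starts in a cone chart and is short enough stays in it, and the
primitive of `ω` is affine along it. -/
lemma straight [T2Space X] {γ : ℝ → X} {v : ℂ} {s t : ℝ}
    (hγ : ContinuousOn γ (Icc s t)) (hd : ∀ r ∈ Ioo s t, S.DevAt (fun r : ℝ => (r : ℂ) * v) γ r)
    (h0 : γ s ∈ K.φ.source) (hρ : ‖K.F (γ s)‖ + (t - s) * ‖v‖ < K.ρ) :
    ∀ r ∈ Icc s t, γ r ∈ K.φ.source ∧ K.F (γ r) = K.F (γ s) + ((r - s : ℝ) : ℂ) * v := by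
  rintro r ⟨hsr, hrt⟩
  rcases hsr.eq_or_lt with rfl | hsr
  · exact ⟨h0, by simp⟩
  have hst := hsr.trans_le hrt
  have hF : Tendsto (fun s' => K.F (γ s')) (𝓝[>] s) (𝓝 (K.F (γ s))) :=
    (K.continuousAt_F h0).tendsto.comp
      (((hγ s ⟨le_rfl, hst.le⟩).mono Ioc_subset_Icc_self).tendsto.mono_left
        (by rw [nhdsWithin_Ioc_eq_nhdsGT hst]))
  have hsrc : ∀ᶠ s' in 𝓝[>] s, γ s' ∈ K.φ.source :=
    (((hγ s ⟨le_rfl, hst.le⟩).mono Ioc_subset_Icc_self).tendsto.mono_left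
        (by rw [nhdsWithin_Ioc_eq_nhdsGT hst])).eventually (K.φ.open_source.mem_nhds h0)
  have hlt : ∀ᶠ s' in 𝓝[>] s, ‖K.F (γ s')‖ + (t - s') * ‖v‖ < K.ρ := by
    have h1 : Tendsto (fun s' : ℝ => ‖K.F (γ s')‖ + (t - s') * ‖v‖) (𝓝[>] s)
        (𝓝 (‖K.F (γ s)‖ + (t - s) * ‖v‖)) := by
      apply Tendsto.add hF.norm
      exact ((continuous_const.sub continuous_id).mul continuous_const).continuousWithinAt
    exact h1.eventually (gt_mem_nhds hρ)
  -- The start `γ s` may be singular, so the path is started slightly later and `s'` then tends to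
  -- `s`.
  have hkey : ∀ᶠ s' in 𝓝[>] s, γ r ∈ K.φ.source ∧
      K.F (γ r) = K.F (γ s') + ((r - s' : ℝ) : ℂ) * v := by
    filter_upwards [hsrc, hlt, Ioo_mem_nhdsGT hsr] with s' h1 h2 h3
    exact K.straight_aux (hγ.mono (Icc_subset_Icc_left h3.1.le))
      (fun q hq => hd q ⟨h3.1.trans_le hq.1, hq.2⟩) h1 h2 r ⟨h3.2.le, hrt⟩
  refine ⟨hkey.exists.choose_spec.1, ?_⟩
  have hlim : Tendsto (fun s' : ℝ => K.F (γ s') + ((r - s' : ℝ) : ℂ) * v) (𝓝[>] s)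
      (𝓝 (K.F (γ s) + ((r - s : ℝ) : ℂ) * v)) := by
    apply Tendsto.add hF
    exact Continuous.continuousWithinAt (by fun_prop)
  exact tendsto_nhds_unique
    (tendsto_const_nhds.congr' (hkey.mono fun s' h => h.2)) hlim

end ConeChart

end TranslationSurface

end Slopes

/-! ### Local finiteness of the set of holonomy vectors. -/

namespace Slopes

namespace TranslationSurface

variable {X : Type*} [TopologicalSpace X]

/-- There is a straight path from `p` to `q` with vector `v` and without singular points in its
interior. -/
def Joins (S : TranslationSurface X) (p q : X) (v : ℂ) : Prop :=
  ∃ γ : ℝ → X, ContinuousOn γ (Icc 0 1) ∧ γ 0 = p ∧ γ 1 = q ∧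
    ∀ t ∈ Ioo (0 : ℝ) 1, S.DevAt (fun r : ℝ => (r : ℂ) * v) γ t

variable {S : TranslationSurface X}

lemma IsSaddleConnection.devAt {γ : ℝ → X} {v : ℂ} (h : S.IsSaddleConnection γ v) {t : ℝ}
    (ht : t ∈ Ioo (0 : ℝ) 1) : S.DevAt (fun r : ℝ => (r : ℂ) * v) γ t where
  continuousAt := h.continuousOn.continuousAt (Icc_mem_nhds ht.1 ht.2)
  regular := h.interior t ht
  dev c hc hz := by
    filter_upwards [h.straight t ht c hc hz] with s hs
    rw [hs]; push_cast; ring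

lemma mem_holonomy_iff {v : ℂ} : v ∈ S.holonomy ↔ ∃ p ∈ S.sing, ∃ q ∈ S.sing, S.Joins p q v := by
  constructor
  · rintro ⟨γ, h⟩
    exact ⟨_, h.start, _, h.finish, γ, h.continuousOn, rfl, rfl, fun t ht => h.devAt ht⟩
  · rintro ⟨p, hp, q, hq, γ, hγ, rfl, rfl, h⟩
    refine ⟨γ, hγ, hp, hq, fun t ht => (h t ht).regular, fun t ht c hc hz => ?_⟩
    filter_upwards [(h t ht).dev c hc hz] with s hs
    rw [hs]; push_cast; ring

lemma ConeChart.exists_preconnected {p : X} (K : S.ConeChart p) {U : Set X} (hU : U ∈ 𝓝 p) :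
    ∃ V ∈ 𝓝 p, IsPreconnected V ∧ V ⊆ U := by
  have h3 : K.φ.symm 0 = p := by rw [← K.center]; exact K.φ.left_inv K.mem_source
  have h0 : (0 : ℂ) ∈ K.φ.target := by rw [← K.center]; exact K.φ.map_source K.mem_source
  have hc : ContinuousAt K.φ.symm 0 := K.φ.continuousAt_symm h0
  have h4 : K.φ.symm ⁻¹' U ∩ K.φ.target ∈ 𝓝 (0 : ℂ) :=
    inter_mem (hc.preimage_mem_nhds (by rwa [h3])) (K.φ.open_target.mem_nhds h0)
  obtain ⟨r, hr, hball⟩ := Metric.mem_nhds_iff.1 h4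
  refine ⟨K.φ.symm '' Metric.ball 0 r, ?_, ?_, ?_⟩
  · have h5 : K.φ ⁻¹' Metric.ball 0 r ∩ K.φ.source ∈ 𝓝 p :=
      inter_mem ((K.φ.continuousAt K.mem_source).preimage_mem_nhds
        (by rw [K.center]; exact Metric.ball_mem_nhds _ hr)) (K.φ.open_source.mem_nhds K.mem_source)
    filter_upwards [h5] with x hx
    exact ⟨K.φ x, hx.1, K.φ.left_inv hx.2⟩
  · exact (convex_ball _ _).isPreconnected.image _
      (K.φ.symm.continuousOn.mono fun w hw => (hball hw).2)
  · rintro _ ⟨w, hw, rfl⟩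
    exact (hball hw).1

/-- The primitives of two cone charts with different centres differ by a constant on every
connected subset of both. -/
lemma ConeChart.F_sub_F {p p' : X} (hne : p ≠ p') (K : S.ConeChart p) (K' : S.ConeChart p')
    {V : Set X} (hV : IsPreconnected V) (hK : V ⊆ K.φ.source) (hK' : V ⊆ K'.φ.source) {x y : X}
    (hx : x ∈ V) (hy : y ∈ V) : K.F x - K.F y = K'.F x - K'.F y := by
  have hloc : ∀ z ∈ V, ∀ᶠ z' in 𝓝 z, K.F z' - K'.F z' = K.F z - K'.F z := by
    intro z hz
    -- A singular point in both domains would be the centre of both charts.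
    have hzs : z ∉ S.sing := fun h => hne ((K.sing z (hK hz) h).symm.trans (K'.sing z (hK' hz) h))
    obtain ⟨c, hc, hzc⟩ := S.cover z hzs
    filter_upwards [K.linear c hc z ⟨hzc, hK hz⟩, K'.linear c hc z ⟨hzc, hK' hz⟩] with z' h1 h2
    simp only [F]
    linear_combination h2 - h1
  have key : V ⊆ interior {z | K.F z - K'.F z = K.F y - K'.F y} := by
    apply hV.subset_of_closure_inter_subset isOpen_interior
    · exact ⟨y, hy, mem_interior_iff_mem_nhds.2 (hloc y hy)⟩
    · rintro z ⟨hz, hzV⟩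
      obtain ⟨w, hw1, hw2⟩ := mem_closure_iff_nhds.1 hz _ (hloc z hzV)
      have hw3 : K.F w - K'.F w = K.F y - K'.F y :=
        interior_subset (s := {z | K.F z - K'.F z = K.F y - K'.F y}) hw2
      have hw4 : K.F w - K'.F w = K.F z - K'.F z := hw1
      apply mem_interior_iff_mem_nhds.2
      filter_upwards [hloc z hzV] with z' hz'
      exact hz'.trans (hw4.symm.trans hw3)
  have : K.F x - K'.F x = K.F y - K'.F y :=
    interior_subset (s := {z | K.F z - K'.F z = K.F y - K'.F y}) (key hx)
  linear_combination this

section Finite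

variable [T2Space X]

/-- Two straight paths with the same endpoints that follow the same chain of charts have the same
vector. -/
lemma eq_of_chain (K : ∀ x, S.ConeChart x) (V : X → Set X) (jj ll : X → X)
    (hjj : ∀ x, x ∈ (K (jj x)).nhd ((K (jj x)).ρ / 4)) (hll : ∀ x, x ∈ V (ll x))
    (hVc : ∀ x, IsPreconnected (V x))
    (hV : ∀ x j, (V x ∩ (K (jj j)).nhd ((K (jj j)).ρ / 2)).Nonempty → V x ⊆ (K (jj j)).φ.source)
    {N : ℕ} (hN : 0 < N) {R : ℝ} (hR : ∀ x, R / N ≤ (K (jj x)).ρ / 4)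
    {γ γ' : ℝ → X} {v v' : ℂ} (hv : ‖v‖ ≤ R) (hv' : ‖v'‖ ≤ R)
    (hγ : ContinuousOn γ (Icc 0 1)) (hγ' : ContinuousOn γ' (Icc 0 1))
    (hd : ∀ t ∈ Ioo (0 : ℝ) 1, S.DevAt (fun r : ℝ => (r : ℂ) * v) γ t)
    (hd' : ∀ t ∈ Ioo (0 : ℝ) 1, S.DevAt (fun r : ℝ => (r : ℂ) * v') γ' t)
    (h0 : γ 0 = γ' 0) (h1 : γ 1 = γ' 1)
    (hj : ∀ i : ℕ, i ≤ N → jj (γ (i / N)) = jj (γ' (i / N)))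
    (hl : ∀ i : ℕ, i ≤ N → ll (γ (i / N)) = ll (γ' (i / N))) : v = v' := by
  have hN' : (0 : ℝ) < N := by exact_mod_cast hN
  -- Each of the N pieces has length at most ρ/4, so a piece that starts where |F| < ρ/4 ends in the
  -- same chart where |F| < ρ/2.
  have step : ∀ (γ : ℝ → X) (v : ℂ), ‖v‖ ≤ R → ContinuousOn γ (Icc 0 1) →
      (∀ t ∈ Ioo (0 : ℝ) 1, S.DevAt (fun r : ℝ => (r : ℂ) * v) γ t) → ∀ i : ℕ, i < N →
      γ ((i + 1 : ℕ) / N) ∈ (K (jj (γ (i / N)))).nhd ((K (jj (γ (i / N)))).ρ / 2) ∧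
      (K (jj (γ (i / N)))).F (γ ((i + 1 : ℕ) / N)) =
        (K (jj (γ (i / N)))).F (γ (i / N)) + (1 / N : ℂ) * v := by
    intro γ v hv hγ hd i hi
    set L := K (jj (γ (i / N)))
    have hL := hjj (γ (i / N))
    have hρ := L.ρ_pos
    have hi0 : (0 : ℝ) ≤ i / N := by positivity
    have hi1 : ((i + 1 : ℕ) : ℝ) / N ≤ 1 := by
      rw [div_le_one hN']; exact_mod_cast hi
    have hlt : (i : ℝ) / N ≤ (i + 1 : ℕ) / N := by
      gcongr; exact_mod_cast Nat.le_succ i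
    have hdiff : ((i + 1 : ℕ) : ℝ) / N - i / N = 1 / N := by push_cast; ring
    have hlen : 1 / (N : ℝ) * ‖v‖ ≤ L.ρ / 4 := by
      refine le_trans ?_ (hR (γ (i / N)))
      rw [one_div, inv_mul_eq_div]
      gcongr
    have hst := L.straight (hγ.mono (Icc_subset_Icc hi0 hi1))
      (fun r hr => hd r ⟨hi0.trans_lt hr.1, hr.2.trans_le hi1⟩) hL.1
      (by rw [hdiff]; linarith [hL.2]) _ ⟨hlt, le_rfl⟩
    rw [hdiff] at hst
    push_cast at hst ⊢
    refine ⟨⟨hst.1, ?_⟩, hst.2⟩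
    rw [hst.2]
    refine (norm_add_le _ _).trans_lt ?_
    have : ‖(1 / N : ℂ) * v‖ = 1 / (N : ℝ) * ‖v‖ := by simp
    rw [this]
    linarith [hL.2]
  -- The gap between the two paths, read in the current chart, grows by (v - v')/N per piece.
  -- Changing the chart preserves it, because both points lie in one connected set contained in both
  -- domains. At `i = N` the gap is zero.
  have key : ∀ i : ℕ, i ≤ N → (K (jj (γ (i / N)))).F (γ (i / N)) -
      (K (jj (γ (i / N)))).F (γ' (i / N)) = (i / N : ℂ) * (v - v') := by
    intro i
    induction i with
    | zero => intro _; simp [h0]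
    | succ i ih =>
      intro hi
      have ih := ih (by omega)
      have hs := step γ v hv hγ hd i (by omega)
      have hs' := step γ' v' hv' hγ' hd' i (by omega)
      rw [← hj i (by omega)] at hs'
      have e : (K (jj (γ (i / N)))).F (γ ((i + 1 : ℕ) / N)) -
          (K (jj (γ (i / N)))).F (γ' ((i + 1 : ℕ) / N)) = ((i + 1 : ℕ) / N : ℂ) * (v - v') := by
        rw [hs.2, hs'.2]
        push_cast
        linear_combination ih
      rw [← e]
      by_cases hne : jj (γ ((i + 1 : ℕ) / N)) = jj (γ (i / N))
      · rw [hne]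
      · have hm := hll (γ ((i + 1 : ℕ) / N))
        have hm' := hll (γ' ((i + 1 : ℕ) / N))
        rw [← hl (i + 1) hi] at hm'
        refine ConeChart.F_sub_F hne _ _ (hVc (ll (γ ((i + 1 : ℕ) / N)))) ?_ ?_ hm hm'
        · exact hV _ _ ⟨_, hm, (K _).nhd_mono (by linarith [(K (jj (γ ((i + 1 : ℕ) / N)))).ρ_pos])
            (hjj (γ ((i + 1 : ℕ) / N)))⟩
        · exact hV _ _ ⟨_, hm, hs.1⟩
  have hfin := key N le_rfl
  rw [div_self hN'.ne', h1, sub_self, div_self (by exact_mod_cast hN'.ne'), one_mul] at hfin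
  exact (sub_eq_zero.1 hfin.symm)

/-- There are only finitely many straight paths of bounded length between two points. -/
lemma finite_joins [CompactSpace X] (S : TranslationSurface X) (p q : X) (R : ℝ) :
    {v : ℂ | ‖v‖ ≤ R ∧ S.Joins p q v}.Finite := by
  classical
  let K : ∀ x, S.ConeChart x := fun x => Classical.arbitrary _
  obtain ⟨J, hJ⟩ := CompactSpace.elim_nhds_subcover (fun x => (K x).nhd ((K x).ρ / 4))
    fun x => (K x).nhd_mem_nhds (by linarith [(K x).ρ_pos])
  have hV : ∀ x, ∃ V ∈ 𝓝 x, IsPreconnected V ∧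
      ∀ j ∈ J, (V ∩ (K j).nhd ((K j).ρ / 2)).Nonempty → V ⊆ (K j).φ.source := by
    intro x
    -- Inside `W j` a neighbourhood of `x` either lies in the domain of chart `j` or misses its
    -- half-size disc altogether.
    let W : X → Set X := fun j => if x ∈ {x | x ∈ (K j).φ.source ∧ ‖(K j).F x‖ ≤ (K j).ρ / 2}
      then (K j).φ.source else {x | x ∈ (K j).φ.source ∧ ‖(K j).F x‖ ≤ (K j).ρ / 2}ᶜ
    have hW : ∀ j ∈ J, W j ∈ 𝓝 x := by
      intro j _
      by_cases hx : x ∈ {x | x ∈ (K j).φ.source ∧ ‖(K j).F x‖ ≤ (K j).ρ / 2}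
      · simp only [W, if_pos hx]
        exact (K j).φ.open_source.mem_nhds hx.1
      · simp only [W, if_neg hx]
        exact ((K j).isClosed_closedNhd (by linarith [(K j).ρ_pos])).isOpen_compl.mem_nhds hx
    obtain ⟨V, h1, h2, h3⟩ := (K x).exists_preconnected ((Filter.biInter_finset_mem J).2 hW)
    refine ⟨V, h1, h2, fun j hj ⟨y, hyV, hy⟩ => ?_⟩
    have hVW : V ⊆ W j := h3.trans (iInter₂_subset j hj)
    by_cases hx : x ∈ {x | x ∈ (K j).φ.source ∧ ‖(K j).F x‖ ≤ (K j).ρ / 2}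
    · simp only [W, if_pos hx] at hVW
      exact hVW
    · simp only [W, if_neg hx] at hVW
      exact absurd ⟨hy.1, hy.2.le⟩ (hVW hyV)
  choose V hV1 hV2 hV3 using hV
  obtain ⟨L, hL⟩ := CompactSpace.elim_nhds_subcover V hV1
  have hjj : ∀ x, ∃ j ∈ J, x ∈ (K j).nhd ((K j).ρ / 4) := fun x => by
    have : x ∈ (⊤ : Set X) := trivial
    rw [← hJ] at this
    simpa using this
  have hll : ∀ x, ∃ l ∈ L, x ∈ V l := fun x => by
    have : x ∈ (⊤ : Set X) := trivial
    rw [← hL] at this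
    simpa using this
  choose jj hjJ hjj using hjj
  choose ll hlL hll using hll
  obtain ⟨j₀, -, hmin⟩ := J.exists_min_image (fun j => (K j).ρ) ⟨_, hjJ p⟩
  obtain ⟨N, hN⟩ := exists_nat_gt (max (4 * R / (K j₀).ρ) 0)
  have hN0 : 0 < N := by exact_mod_cast (le_max_right _ _).trans_lt hN
  have hN0' : (0 : ℝ) < N := by exact_mod_cast hN0
  have hR : ∀ x, R / N ≤ (K (jj x)).ρ / 4 := by
    intro x
    have h1 := hmin _ (hjJ x)
    have h2 := (le_max_left _ _).trans_lt hN
    have h3 := (K j₀).ρ_pos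
    rw [div_lt_iff₀ h3] at h2
    rw [div_le_iff₀ hN0']
    nlinarith
  have : Nonempty (ℝ → X) := ⟨fun _ => p⟩
  choose! γ hγ using fun (v : ℂ) (hv : S.Joins p q v) => hv
  -- The itinerary of the path at the `N + 1` division points; by `eq_of_chain` it determines the
  -- vector, and there are finitely many itineraries.
  let code : ℂ → Fin (N + 1) → J × L := fun v i =>
    (⟨_, hjJ (γ v ((i : ℕ) / N))⟩, ⟨_, hlL (γ v ((i : ℕ) / N))⟩)
  refine Set.Finite.of_injOn (f := code) (t := univ) (fun _ _ => mem_univ _) ?_ finite_univ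
  rintro v ⟨hv, hvj⟩ v' ⟨hv', hvj'⟩ e
  obtain ⟨a1, a2, a3, a4⟩ := hγ v hvj
  obtain ⟨b1, b2, b3, b4⟩ := hγ v' hvj'
  have e' : ∀ i : ℕ, i ≤ N → jj (γ v (i / N)) = jj (γ v' (i / N)) ∧
      ll (γ v (i / N)) = ll (γ v' (i / N)) := by
    intro i hi
    have := congrFun e ⟨i, by omega⟩
    simpa [code] using this
  exact eq_of_chain K V jj ll hjj hll hV2 (fun x j => hV3 x _ (hjJ j)) hN0 hR hv hv' a1 b1 a4 b4
    (a2.trans b2.symm) (a3.trans b3.symm) (fun i hi => (e' i hi).1) (fun i hi => (e' i hi).2)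

lemma finite_holonomy [CompactSpace X] (S : TranslationSurface X) (R : ℝ) :
    {v | ‖v‖ ≤ R ∧ v ∈ S.holonomy}.Finite := by
  refine (S.finite_sing.biUnion fun p _ => S.finite_sing.biUnion fun q _ =>
    finite_joins S p q R).subset ?_
  rintro v ⟨hv, h⟩
  obtain ⟨p, hp, q, hq, h⟩ := mem_holonomy_iff.1 h
  simp only [mem_iUnion]
  exact ⟨p, hp, q, hq, hv, h⟩

end Finite

end TranslationSurface

end Slopes

/-! ### The exponential map and its first singular points. -/

namespace Slopes

namespace TranslationSurface

variable {X : Type*} [TopologicalSpace X] {S : TranslationSurface X}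

lemma DevAt.line {g : ℂ → X} {u v : ℂ} {t : ℝ} (h : S.DevAt id g (u + t * v)) :
    S.DevAt (fun r : ℝ => (r : ℂ) * v) (fun r : ℝ => g (u + r * v)) t := by
  have h1 : S.DevAt (id ∘ fun r : ℝ => u + r * v) (g ∘ fun r : ℝ => u + r * v) t :=
    DevAt.comp (k := fun r : ℝ => u + r * v) h (by fun_prop)
  exact h1.congr_dev fun z' => by simp

/-- Along a segment on which `g` is a local isometry, `F ∘ g` is a translation as long as the
segment is short. -/
lemma ConeChart.F_segment [T2Space X] {p : X} (K : S.ConeChart p) {g : ℂ → X} {u v : ℂ}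
    (h : ∀ t ∈ Icc (0 : ℝ) 1, S.DevAt id g (u + t * v)) (h0 : g u ∈ K.φ.source)
    (hρ : ‖K.F (g u)‖ + ‖v‖ < K.ρ) :
    g (u + v) ∈ K.φ.source ∧ K.F (g (u + v)) = K.F (g u) + v := by
  have h1 := K.straight (γ := fun r : ℝ => g (u + r * v)) (s := 0) (t := 1) (v := v)
    (fun t ht => (h t ht).line.continuousAt.continuousWithinAt)
    (fun t ht => (h t ⟨ht.1.le, ht.2.le⟩).line) (by simpa using h0) (by simpa using hρ) 1
    ⟨zero_le_one, le_rfl⟩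
  simpa using h1

/-- The local inverse of a natural coordinate is a local isometry. -/
lemma ConeChart.devAt_symm {p : X} (K : S.ConeChart p) (hm : K.m = 1) (hp : p ∉ S.sing) {v z : ℂ}
    (hz : z ∈ Metric.ball v K.ρ) : S.DevAt id (fun z => K.φ.symm (z - v)) z := by
  have hT : ∀ z ∈ Metric.ball v K.ρ, z - v ∈ K.φ.target := by
    intro z hz
    apply K.target
    rwa [hm, pow_one, ← dist_eq_norm]
  have hcont : ContinuousAt (fun z => K.φ.symm (z - v)) z :=
    (K.φ.continuousAt_symm (hT z hz)).comp (f := fun z => z - v) (by fun_prop)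
  have hsrc := K.φ.map_target (hT z hz)
  refine ⟨hcont, fun h => hp (K.sing _ hsrc h ▸ h), fun d hd hzd => ?_⟩
  filter_upwards [hcont.eventually (K.linear d hd _ ⟨hzd, hsrc⟩),
    Metric.isOpen_ball.mem_nhds hz] with z' h1 h2
  rw [h1, K.φ.right_inv (hT z hz), K.φ.right_inv (hT z' h2), hm]
  simp

/-- The domain of the exponential map at `o`. -/
def expDom (S : TranslationSurface X) (o : X) : Set ℂ :=
  {v | ∃ (D : Set ℂ) (g : ℂ → X), IsOpen D ∧ Convex ℝ D ∧ 0 ∈ D ∧ v ∈ D ∧ g 0 = o ∧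
    ∀ z ∈ D, S.DevAt id g z}

lemma isOpen_expDom (o : X) : IsOpen (S.expDom o) := by
  rw [isOpen_iff_mem_nhds]
  rintro v ⟨D, g, h1, h2, h3, h4, h5⟩
  filter_upwards [h1.mem_nhds h4] with w hw
  exact ⟨D, g, h1, h2, h3, hw, h5⟩

lemma expDom_star {o : X} {v : ℂ} (hv : v ∈ S.expDom o) {s : ℝ} (h0 : 0 ≤ s) (h1 : s ≤ 1) :
    (s : ℂ) * v ∈ S.expDom o := by
  obtain ⟨D, g, a1, a2, a3, a4, a5⟩ := hv
  refine ⟨D, g, a1, a2, a3, ?_, a5⟩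
  have := a2.smul_mem_of_zero_mem a3 a4 ⟨h0, h1⟩
  simpa using this

lemma zero_mem_expDom [T2Space X] {o : X} (ho : o ∉ S.sing) : (0 : ℂ) ∈ S.expDom o := by
  obtain ⟨K, hm⟩ := ConeChart.exists_of_regular ho
  refine ⟨_, _, Metric.isOpen_ball, convex_ball _ _, Metric.mem_ball_self K.ρ_pos,
    Metric.mem_ball_self K.ρ_pos, ?_, fun z hz => K.devAt_symm hm ho hz⟩
  simp only [sub_zero]
  rw [← K.center, K.φ.left_inv K.mem_source]

/-- `g` is the exponential map at `o`. -/
structure IsExp (S : TranslationSurface X) (o : X) (g : ℂ → X) : Prop where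
  zero : g 0 = o
  devAt : ∀ v ∈ S.expDom o, S.DevAt id g v

/-- Two convex domains containing 0 meet in a connected set, so by `DevAt.eqOn` the local solutions
agree there and glue to one map. -/
lemma exists_isExp [T2Space X] (S : TranslationSurface X) (o : X) : ∃ g, S.IsExp o g := by
  classical
  let P : ℂ → Set ℂ → (ℂ → X) → Prop := fun v D g => IsOpen D ∧ Convex ℝ D ∧ 0 ∈ D ∧ v ∈ D ∧
    g 0 = o ∧ ∀ z ∈ D, S.DevAt id g z
  have huniq : ∀ v v' w D D' g g', P v D g → P v' D' g' → w ∈ D → w ∈ D' → g w = g' w := by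
    rintro v v' w D D' g g' ⟨a1, a2, a3, a4, a5, a6⟩ ⟨b1, b2, b3, b4, b5, b6⟩ hw hw'
    exact DevAt.eqOn (a2.inter b2).isPreconnected (fun z hz => a6 z hz.1) (fun z hz => b6 z hz.2)
      (⟨a3, b3⟩ : (0 : ℂ) ∈ D ∩ D') (a5.trans b5.symm) ⟨hw, hw'⟩
  have hex : ∀ v : ℂ, ∃ x : X, (v = 0 → x = o) ∧ ∀ D g, P v D g → x = g v := by
    intro v
    by_cases hv : v ∈ S.expDom o
    · obtain ⟨D, g, h⟩ := hv
      refine ⟨g v, ?_, fun D' g' h' => huniq v v v D D' g g' h h' h.2.2.2.1 h'.2.2.2.1⟩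
      rintro rfl
      exact h.2.2.2.2.1
    · exact ⟨o, fun _ => rfl, fun D g h => absurd ⟨D, g, h⟩ hv⟩
  choose G hG0 hG using hex
  refine ⟨G, hG0 0 rfl, ?_⟩
  rintro v ⟨D, g, a1, a2, a3, a4, a5, a6⟩
  refine (a6 v a4).congr ?_
  filter_upwards [a1.mem_nhds a4] with w hw
  exact hG w D g ⟨a1, a2, a3, hw, a5, a6⟩

lemma exists_first_exit [T2Space X] {o : X} {v : ℂ} (ho : o ∉ S.sing) (hv : v ∉ S.expDom o) :
    ∃ s : ℝ, 0 < s ∧ s ≤ 1 ∧ (s : ℂ) * v ∉ S.expDom o ∧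
      ∀ r : ℝ, 0 ≤ r → r < s → (r : ℂ) * v ∈ S.expDom o := by
  have hcl : IsClosed ({r : ℝ | (r : ℂ) * v ∉ S.expDom o} ∩ Icc 0 1) := by
    refine IsClosed.inter ?_ isClosed_Icc
    exact (isOpen_expDom o).isClosed_compl.preimage
      (f := fun r : ℝ => (r : ℂ) * v) (by fun_prop)
  have hne : ({r : ℝ | (r : ℂ) * v ∉ S.expDom o} ∩ Icc 0 1).Nonempty :=
    ⟨1, by simpa using hv, by simp⟩
  have hbdd : BddBelow ({r : ℝ | (r : ℂ) * v ∉ S.expDom o} ∩ Icc 0 1) := ⟨0, fun r hr => hr.2.1⟩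
  have hmem := hcl.csInf_mem hne hbdd
  set s := sInf ({r : ℝ | (r : ℂ) * v ∉ S.expDom o} ∩ Icc 0 1)
  refine ⟨s, ?_, hmem.2.2, hmem.1, fun r hr hrs => ?_⟩
  · refine hmem.2.1.lt_of_ne fun h => hmem.1 ?_
    rw [← h]
    simpa using zero_mem_expDom ho
  · by_contra h
    exact absurd (csInf_le hbdd ⟨h, hr, hrs.le.trans hmem.2.2⟩) (not_le.2 hrs)

section Limit

variable [T2Space X]

/-- `g (s v)` follows the cone chart at its limit point. -/
lemma ConeChart.F_ray {p : X} (K : S.ConeChart p) {o : X} {g : ℂ → X} (hg : S.IsExp o g) {v : ℂ}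
    (hv : ∀ s : ℝ, 0 ≤ s → s < 1 → (s : ℂ) * v ∈ S.expDom o)
    (hp : MapClusterPt p (𝓝[<] 1) (fun s : ℝ => g ((s : ℂ) * v))) :
    ∀ᶠ s : ℝ in 𝓝[<] 1, g ((s : ℂ) * v) ∈ K.φ.source ∧
      K.F (g ((s : ℂ) * v)) = ((s - 1 : ℝ) : ℂ) * v := by
  have hρ := K.ρ_pos
  have hseg : ∀ s t : ℝ, 0 ≤ s → s ≤ t → t < 1 → g ((s : ℂ) * v) ∈ K.φ.source →
      ‖K.F (g ((s : ℂ) * v))‖ + (1 - s) * ‖v‖ < K.ρ →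
      g ((t : ℂ) * v) ∈ K.φ.source ∧
        K.F (g ((t : ℂ) * v)) = K.F (g ((s : ℂ) * v)) + ((t - s : ℝ) : ℂ) * v := by
    intro s t hs hst ht h1 h2
    have := K.F_segment (g := g) (u := (s : ℂ) * v) (v := ((t - s : ℝ) : ℂ) * v) ?_ h1 ?_
    · have e : (s : ℂ) * v + ((t - s : ℝ) : ℂ) * v = t * v := by push_cast; ring
      rwa [e] at this
    · intro r hr
      have e : (s : ℂ) * v + (r : ℂ) * (((t - s : ℝ) : ℂ) * v) = ((s + r * (t - s) : ℝ) : ℂ) * v := by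
        push_cast; ring
      rw [e]
      refine hg.devAt _ (hv _ ?_ ?_)
      · have := mul_nonneg hr.1 (sub_nonneg.2 hst); linarith
      · have := mul_le_mul_of_nonneg_right hr.2 (sub_nonneg.2 hst); linarith
    · rw [norm_mul, Complex.norm_real, Real.norm_of_nonneg (by linarith)]
      have := mul_le_mul_of_nonneg_right (by linarith : t - s ≤ 1 - s) (norm_nonneg v)
      linarith
  have hsmall : ∀ ε > 0, ∃ s : ℝ, 0 ≤ s ∧ s < 1 ∧ g ((s : ℂ) * v) ∈ K.φ.source ∧
      ‖K.F (g ((s : ℂ) * v))‖ < ε ∧ (1 - s) * ‖v‖ < ε := by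
    intro ε hε
    have h1 := hp.frequently (K.nhd_mem_nhds hε)
    have h2 : ∀ᶠ s : ℝ in 𝓝[<] 1, (1 - s) * ‖v‖ < ε := by
      have : Tendsto (fun s : ℝ => (1 - s) * ‖v‖) (𝓝[<] 1) (𝓝 ((1 - 1) * ‖v‖)) :=
        Continuous.continuousWithinAt (by fun_prop)
      exact this.eventually (gt_mem_nhds (by simpa using hε))
    have h3 : ∀ᶠ s : ℝ in 𝓝[<] 1, s ∈ Ioo (0 : ℝ) 1 := Ioo_mem_nhdsLT one_pos
    obtain ⟨s, hs, h4, h5⟩ := (h1.and_eventually (h2.and h3)).exists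
    exact ⟨s, h5.1.le, h5.2, hs.1, hs.2, h4⟩
  obtain ⟨s, hs0, hs1, hsrc, hF, hl⟩ := hsmall (K.ρ / 2) (by linarith)
  -- By `hseg` this quantity is the same at any two times of near approach to `p`, and by `hsmall`
  -- it is arbitrarily small at some of them.
  have hzero : K.F (g ((s : ℂ) * v)) + ((1 - s : ℝ) : ℂ) * v = 0 := by
    rw [← norm_eq_zero]
    refine le_antisymm (le_of_forall_pos_lt_add fun ε hε => ?_) (norm_nonneg _)
    rw [zero_add]
    obtain ⟨t, ht0, ht1, htsrc, htF, htl⟩ := hsmall (min (ε / 2) (K.ρ / 2))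
      (by positivity)
    have ha := htF.trans_le (min_le_left _ _)
    have hb := htl.trans_le (min_le_left _ _)
    have ha' := htF.trans_le (min_le_right _ _)
    have hb' := htl.trans_le (min_le_right _ _)
    have e : K.F (g ((s : ℂ) * v)) + ((1 - s : ℝ) : ℂ) * v =
        K.F (g ((t : ℂ) * v)) + ((1 - t : ℝ) : ℂ) * v := by
      rcases le_total s t with hst | hst
      · rw [(hseg s t hs0 hst ht1 hsrc (by linarith)).2]; push_cast; ring
      · rw [(hseg t s ht0 hst hs1 htsrc (by linarith)).2]; push_cast; ring
    rw [e]
    refine (norm_add_le _ _).trans_lt ?_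
    rw [norm_mul, Complex.norm_real, Real.norm_of_nonneg (by linarith)]
    linarith
  filter_upwards [Ioo_mem_nhdsLT hs1] with t ht
  have := hseg s t hs0 ht.1.le ht.2 hsrc (by linarith)
  refine ⟨this.1, ?_⟩
  rw [this.2]
  push_cast at hzero ⊢
  linear_combination hzero

/-- Near time 1 the primitive along the ray is (s - 1) v, which tends to 0; so a cluster point is
already the limit. -/
lemma tendsto_ray {p o : X} {g : ℂ → X} (hg : S.IsExp o g) {v : ℂ}
    (hv : ∀ s : ℝ, 0 ≤ s → s < 1 → (s : ℂ) * v ∈ S.expDom o)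
    (hp : MapClusterPt p (𝓝[<] 1) (fun s : ℝ => g ((s : ℂ) * v))) :
    Tendsto (fun s : ℝ => g ((s : ℂ) * v)) (𝓝[<] 1) (𝓝 p) := by
  let K : S.ConeChart p := Classical.arbitrary _
  have h := K.F_ray hg hv hp
  refine K.tendsto_center (h.mono fun s hs => hs.1) ?_
  have h1 : Tendsto (fun s : ℝ => ((s - 1 : ℝ) : ℂ) * v) (𝓝[<] 1) (𝓝 (((1 - 1 : ℝ) : ℂ) * v)) :=
    Continuous.continuousWithinAt (by fun_prop)
  simp only [sub_self, Complex.ofReal_zero, zero_mul] at h1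
  exact h1.congr' (h.mono fun s hs => hs.2.symm)

/-- The exponential map extends past a regular limit point. -/
lemma mem_expDom_of_tendsto {p o : X} {g : ℂ → X} (hg : S.IsExp o g) {v : ℂ}
    (hv : ∀ s : ℝ, 0 ≤ s → s < 1 → (s : ℂ) * v ∈ S.expDom o)
    (hp : Tendsto (fun s : ℝ => g ((s : ℂ) * v)) (𝓝[<] 1) (𝓝 p)) (hps : p ∉ S.sing) :
    v ∈ S.expDom o := by
  classical
  obtain ⟨K, hm⟩ := ConeChart.exists_of_regular hps
  have hρ := K.ρ_pos
  set h : ℂ → X := fun z => K.φ.symm (z - v) with hdef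
  have hlen : ∀ᶠ s : ℝ in 𝓝[<] 1, (1 - s) * ‖v‖ < K.ρ / 2 := by
    have : Tendsto (fun s : ℝ => (1 - s) * ‖v‖) (𝓝[<] 1) (𝓝 ((1 - 1) * ‖v‖)) :=
      Continuous.continuousWithinAt (by fun_prop)
    exact this.eventually (gt_mem_nhds (by simpa using hρ))
  obtain ⟨s, ⟨hs1, hs2⟩, hs3, hs4⟩ :=
    ((K.F_ray hg hv hp.mapClusterPt).and (hlen.and (Ioo_mem_nhdsLT one_pos))).exists
  have hgh : g ((s : ℂ) * v) = h ((s : ℂ) * v) := by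
    rw [← K.φ.left_inv hs1, hdef]
    simp only [ConeChart.F, hm, pow_one] at hs2
    rw [hs2]
    congr 1
    push_cast; ring
  have hseg : segment ℝ 0 ((s : ℂ) * v) ⊆ S.expDom o := by
    rw [segment_eq_image]
    rintro _ ⟨t, ht, rfl⟩
    simp only [smul_zero, zero_add, Complex.real_smul]
    exact expDom_star (hv s hs4.1.le hs4.2) ht.1 ht.2
  have hcpt : IsCompact (segment ℝ 0 ((s : ℂ) * v)) := by
    rw [segment_eq_image]
    exact isCompact_Icc.image (by fun_prop)
  obtain ⟨δ', hδ', hthick'⟩ := hcpt.exists_thickening_subset_open (isOpen_expDom o) hseg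
  set δ := min δ' (K.ρ / 2)
  have hδ : 0 < δ := by positivity
  set A := Metric.thickening δ (segment ℝ 0 ((s : ℂ) * v))
  have hA : A ⊆ S.expDom o := (Metric.thickening_mono (min_le_left _ _) _).trans hthick'
  have hAc : Convex ℝ A := (convex_segment _ _).thickening δ
  have hAo : IsOpen A := Metric.isOpen_thickening
  have hgA : ∀ z ∈ A, S.DevAt id g z := fun z hz => hg.devAt z (hA hz)
  have hB : ∀ z ∈ Metric.ball v K.ρ, S.DevAt id h z := fun z hz => K.devAt_symm hm hps hz
  have hsA : (s : ℂ) * v ∈ A := Metric.self_subset_thickening hδ _ (right_mem_segment _ _ _)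
  have hsB : (s : ℂ) * v ∈ Metric.ball v K.ρ := by
    rw [Metric.mem_ball, dist_eq_norm]
    have e : (s : ℂ) * v - v = ((s - 1 : ℝ) : ℂ) * v := by push_cast; ring
    rw [e, norm_mul, Complex.norm_real, Real.norm_of_nonpos (by linarith [hs4.2])]
    linarith
  have hAB : EqOn g h (A ∩ Metric.ball v K.ρ) :=
    DevAt.eqOn (hAc.inter (convex_ball _ _)).isPreconnected (fun z hz => hgA z hz.1)
      (fun z hz => hB z hz.2) ⟨hsA, hsB⟩ hgh
  have h0A : (0 : ℂ) ∈ A := Metric.self_subset_thickening hδ _ (left_mem_segment _ _ _)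
  -- A thin convex neighbourhood of the whole segment is covered by `A`, where `g` is used, and the
  -- ball about `v`, where the inverse natural coordinate is used; both agree on the overlap.
  refine ⟨Metric.thickening δ (segment ℝ 0 v), fun z => if z ∈ A then g z else h z,
    Metric.isOpen_thickening, (convex_segment _ _).thickening δ,
    Metric.self_subset_thickening hδ _ (left_mem_segment _ _ _),
    Metric.self_subset_thickening hδ _ (right_mem_segment _ _ _), (if_pos h0A).trans hg.zero, ?_⟩
  intro z hz
  by_cases hzA : z ∈ A
  · refine (hgA z hzA).congr ?_
    filter_upwards [hAo.mem_nhds hzA] with y hy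
    exact if_pos hy
  · have hzB : z ∈ Metric.ball v K.ρ := by
      obtain ⟨y, hy, hzy⟩ := Metric.mem_thickening_iff.1 hz
      rw [segment_eq_image] at hy
      obtain ⟨t, ht, rfl⟩ := hy
      simp only [smul_zero, zero_add, Complex.real_smul] at hzy
      rcases le_or_gt t s with hts | hts
      · refine absurd (Metric.mem_thickening_iff.2 ⟨(t : ℂ) * v, ?_, hzy⟩) hzA
        rw [segment_eq_image]
        refine ⟨t / s, ⟨div_nonneg ht.1 hs4.1.le, div_le_one_of_le₀ hts hs4.1.le⟩, ?_⟩
        have : (s : ℂ) ≠ 0 := by exact_mod_cast hs4.1.ne'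
        simp only [smul_zero, zero_add, Complex.real_smul]
        push_cast
        field_simp
      · have e : dist ((t : ℂ) * v) v ≤ (1 - s) * ‖v‖ := by
          have e : (t : ℂ) * v - v = ((t - 1 : ℝ) : ℂ) * v := by push_cast; ring
          rw [dist_eq_norm, e, norm_mul, Complex.norm_real, Real.norm_of_nonpos (by linarith [ht.2])]
          exact mul_le_mul_of_nonneg_right (by linarith) (norm_nonneg _)
        have hδρ : δ ≤ K.ρ / 2 := min_le_right _ _
        rw [Metric.mem_ball]
        linarith [dist_triangle z ((t : ℂ) * v) v]
    refine (hB z hzB).congr ?_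
    filter_upwards [Metric.isOpen_ball.mem_nhds hzB] with y hy
    by_cases hyA : y ∈ A
    · rw [if_pos hyA]; exact hAB ⟨hyA, hy⟩
    · rw [if_neg hyA]

/-- A ray that leaves the domain of the exponential map runs into a singular point. -/
lemma exists_sing_of_exit [CompactSpace X] {o : X} {g : ℂ → X} (hg : S.IsExp o g) {v : ℂ}
    (hv : ∀ s : ℝ, 0 ≤ s → s < 1 → (s : ℂ) * v ∈ S.expDom o) (hv1 : v ∉ S.expDom o) :
    ∃ p ∈ S.sing, Tendsto (fun s : ℝ => g ((s : ℂ) * v)) (𝓝[<] 1) (𝓝 p) := by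
  obtain ⟨p, hp⟩ : ∃ p, MapClusterPt p (𝓝[<] 1) (fun s : ℝ => g ((s : ℂ) * v)) :=
    exists_clusterPt_of_compactSpace _
  have h := tendsto_ray hg hv hp
  exact ⟨p, by_contra fun hps => hv1 (mem_expDom_of_tendsto hg hv h hps), h⟩

end Limit

end TranslationSurface

end Slopes

/-! ### Saddle connections between visible points. -/

namespace Slopes

lemma tendsto_one_sub_nhdsGT : Tendsto (fun μ : ℝ => 1 - μ) (𝓝[>] 0) (𝓝[<] 1) := by
  refine tendsto_nhdsWithin_iff.2 ⟨?_, ?_⟩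
  · have : Tendsto (fun μ : ℝ => 1 - μ) (𝓝[>] 0) (𝓝 (1 - 0)) :=
      Continuous.continuousWithinAt (by fun_prop)
    simpa using this
  · filter_upwards [self_mem_nhdsWithin] with μ hμ
    have : (0 : ℝ) < μ := hμ
    show 1 - μ < 1
    linarith

lemma tendsto_one_sub_nhdsLT : Tendsto (fun μ : ℝ => 1 - μ) (𝓝[<] 1) (𝓝[>] 0) := by
  refine tendsto_nhdsWithin_iff.2 ⟨?_, ?_⟩
  · have : Tendsto (fun μ : ℝ => 1 - μ) (𝓝[<] 1) (𝓝 (1 - 1)) :=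
      Continuous.continuousWithinAt (by fun_prop)
    simpa using this
  · filter_upwards [self_mem_nhdsWithin] with μ hμ
    have : μ < 1 := hμ
    show 0 < 1 - μ
    linarith

/-- The determinant of two vectors of the plane. -/
def cross (u v : ℂ) : ℝ := u.re * v.im - u.im * v.re

namespace TranslationSurface

variable {X : Type*} [TopologicalSpace X] {S : TranslationSurface X}

section Ray

variable [T2Space X] [CompactSpace X]

/-- Straight paths from `o` are the images of rays under the exponential map. -/
lemma exp_ray {o : X} {g : ℂ → X} (hg : S.IsExp o g) {γ : ℝ → X} {v : ℂ} (h0 : γ 0 = o)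
    (hγ : ∀ s ∈ Ico (0 : ℝ) 1, S.DevAt (fun r : ℝ => (r : ℂ) * v) γ s) :
    ∀ s ∈ Ico (0 : ℝ) 1, (s : ℂ) * v ∈ S.expDom o ∧ g ((s : ℂ) * v) = γ s := by
  have ho : o ∉ S.sing := h0 ▸ (hγ 0 (by simp)).regular
  have agree : ∀ s : ℝ, s ≤ 1 → (∀ r : ℝ, 0 ≤ r → r < s → (r : ℂ) * v ∈ S.expDom o) →
      ∀ r ∈ Ico (0 : ℝ) s, g ((r : ℂ) * v) = γ r := by
    intro s hs hr r hrs
    refine DevAt.eqOn (D := fun r : ℝ => (r : ℂ) * v) (g := fun r : ℝ => g ((r : ℂ) * v))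
      (isPreconnected_Ico (a := 0) (b := s))
      (fun r hr' => ?_) (fun r hr' => hγ r ⟨hr'.1, hr'.2.trans_le hs⟩)
      (⟨le_rfl, hrs.1.trans_lt hrs.2⟩ : (0 : ℝ) ∈ Ico 0 s) (by simp [hg.zero, h0]) hrs
    have := DevAt.line (u := 0) (v := v) (t := r)
      (by simpa using hg.devAt _ (hr r hr'.1 hr'.2))
    simpa using this
  have hmem : ∀ s ∈ Ico (0 : ℝ) 1, (s : ℂ) * v ∈ S.expDom o := by
    intro s hs
    by_contra hcon
    -- At its first exit the ray would converge to a singular point, but it follows `γ`, whose value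
    -- at that time is regular. The vector is rescaled below so that the exit occurs at time 1.
    obtain ⟨t, ht0, ht1, hts, htr⟩ := exists_first_exit ho hcon
    have hs0 : 0 < s := hs.1.lt_of_ne fun h => hcon (by
      rw [← h]; simpa using zero_mem_expDom ho)
    set s' := t * s with hs'
    have hs'0 : 0 < s' := mul_pos ht0 hs0
    have hs'1 : s' < 1 := (mul_le_of_le_one_left hs.1 ht1).trans_lt hs.2
    have hexit : ((s' : ℝ) : ℂ) * v ∉ S.expDom o := by
      rw [hs']; push_cast; rwa [mul_assoc]
    have hin : ∀ r : ℝ, 0 ≤ r → r < s' → (r : ℂ) * v ∈ S.expDom o := by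
      intro r hr0 hr
      have := htr (r / s) (by positivity) (by rwa [div_lt_iff₀ hs0])
      have hsc : (s : ℂ) ≠ 0 := by exact_mod_cast hs0.ne'
      have e : ((r / s : ℝ) : ℂ) * (s * v) = r * v := by push_cast; field_simp
      rwa [e] at this
    have hscale : ∀ r : ℝ, (r : ℂ) * ((s' : ℂ) * v) = ((r * s' : ℝ) : ℂ) * v := fun r => by
      push_cast; ring
    obtain ⟨p, hp, hlim⟩ := exists_sing_of_exit hg (v := (s' : ℂ) * v) (fun r hr0 hr1 => by
      rw [hscale]
      exact hin _ (by positivity) (by nlinarith)) hexit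
    have hlim2 : Tendsto (fun r : ℝ => γ (r * s')) (𝓝[<] 1) (𝓝 (γ s')) := by
      have h1 : ContinuousAt γ (1 * s') := by
        rw [one_mul]; exact (hγ s' ⟨hs'0.le, hs'1⟩).continuousAt
      have h2 : ContinuousAt (fun r : ℝ => γ (r * s')) 1 :=
        ContinuousAt.comp (f := fun r : ℝ => r * s') h1 (by fun_prop)
      have h3 := h2.tendsto.mono_left (nhdsWithin_le_nhds (s := Iio 1))
      rwa [one_mul] at h3
    have hlim3 : Tendsto (fun r : ℝ => γ (r * s')) (𝓝[<] 1) (𝓝 p) := by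
      refine hlim.congr' ?_
      filter_upwards [Ioo_mem_nhdsLT one_pos] with r hr
      rw [hscale]
      exact agree s' hs'1.le hin _ ⟨mul_nonneg hr.1.le hs'0.le, by nlinarith [hr.2]⟩
    exact (hγ s' ⟨hs'0.le, hs'1⟩).regular (tendsto_nhds_unique hlim3 hlim2 ▸ hp)
  exact fun s hs => ⟨hmem s hs, agree 1 le_rfl (fun r h0 h1 => hmem r ⟨h0, h1⟩) s hs⟩

-- Points near the corner are reached from the ray of `u` by the short segment from (1 - μ) u in
-- direction μ v. That segment stays in the domain because each of its points is a multiple, by a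
-- factor at most 1, of a point between `u` and `v`. The primitive at its end is μ (v - u), which
-- tends to 0.
omit [CompactSpace X] in
lemma tendsto_corner {o p : X} {g : ℂ → X} (hg : S.IsExp o g) {u v : ℂ}
    (hu : ∀ s : ℝ, 0 ≤ s → s < 1 → (s : ℂ) * u ∈ S.expDom o)
    (hp : Tendsto (fun s : ℝ => g ((s : ℂ) * u)) (𝓝[<] 1) (𝓝 p))
    (hseg : ∀ μ : ℝ, 0 < μ → μ < 1 → ((1 - μ : ℝ) : ℂ) * u + (μ : ℂ) * v ∈ S.expDom o) :
    Tendsto (fun μ : ℝ => g (((1 - μ : ℝ) : ℂ) * u + (μ : ℂ) * v)) (𝓝[>] 0) (𝓝 p) := by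
  let K : S.ConeChart p := Classical.arbitrary _
  have hlen : ∀ᶠ μ : ℝ in 𝓝[>] 0, μ * ‖u‖ + μ * ‖v‖ < K.ρ := by
    have : Tendsto (fun μ : ℝ => μ * ‖u‖ + μ * ‖v‖) (𝓝[>] 0) (𝓝 (0 * ‖u‖ + 0 * ‖v‖)) :=
      Continuous.continuousWithinAt (by fun_prop)
    exact this.eventually (gt_mem_nhds (by simpa using K.ρ_pos))
  have key : ∀ᶠ μ : ℝ in 𝓝[>] 0, g (((1 - μ : ℝ) : ℂ) * u + (μ : ℂ) * v) ∈ K.φ.source ∧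
      K.F (g (((1 - μ : ℝ) : ℂ) * u + (μ : ℂ) * v)) = (μ : ℂ) * (v - u) := by
    filter_upwards [tendsto_one_sub_nhdsGT.eventually (K.F_ray hg hu hp.mapClusterPt), hlen,
      Ioo_mem_nhdsGT one_pos] with μ h1 h2 h3
    have hn : ‖K.F (g (((1 - μ : ℝ) : ℂ) * u))‖ = μ * ‖u‖ := by
      rw [h1.2, norm_mul, Complex.norm_real, Real.norm_of_nonpos (by linarith [h3.1])]
      ring
    have hn' : ‖(μ : ℂ) * v‖ = μ * ‖v‖ := by
      rw [norm_mul, Complex.norm_real, Real.norm_of_nonneg h3.1.le]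
    have := K.F_segment (g := g) (u := ((1 - μ : ℝ) : ℂ) * u) (v := (μ : ℂ) * v) ?_ h1.1
      (by rw [hn, hn']; exact h2)
    · refine ⟨this.1, ?_⟩
      rw [this.2, h1.2]
      push_cast; ring
    · intro t ht
      refine hg.devAt _ ?_
      rcases ht.1.eq_or_lt with rfl | ht0
      · simpa using hu (1 - μ) (by linarith [h3.2]) (by linarith [h3.1])
      · have hsum : 0 < 1 - μ + t * μ := by nlinarith [h3.1, h3.2]
        have hsum1 : 1 - μ + t * μ ≤ 1 := by nlinarith [h3.1, ht.2]
        have hlt : t * μ / (1 - μ + t * μ) < 1 := by rw [div_lt_one hsum]; linarith [h3.2]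
        have := expDom_star (hseg (t * μ / (1 - μ + t * μ))
          (div_pos (mul_pos ht0 h3.1) hsum) hlt) hsum.le hsum1
        have hq : t * μ / (1 - μ + t * μ) * (1 - μ + t * μ) = t * μ := div_mul_cancel₀ _ hsum.ne'
        set q := t * μ / (1 - μ + t * μ)
        have hqc : (q : ℂ) * (1 - μ + t * μ) = t * μ := by exact_mod_cast hq
        have e : ((1 - μ : ℝ) : ℂ) * u + (t : ℂ) * ((μ : ℂ) * v) =
            ((1 - μ + t * μ : ℝ) : ℂ) * (((1 - q : ℝ) : ℂ) * u + (q : ℂ) * v) := by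
          push_cast
          linear_combination (u - v) * hqc
        rwa [e]
  refine K.tendsto_center (key.mono fun μ h => h.1) ?_
  have h1 : Tendsto (fun μ : ℝ => (μ : ℂ) * (v - u)) (𝓝[>] 0) (𝓝 (((0 : ℝ) : ℂ) * (v - u))) :=
    Continuous.continuousWithinAt (by fun_prop)
  simp only [Complex.ofReal_zero, zero_mul] at h1
  exact h1.congr' (key.mono fun μ h => h.2.symm)

/-- The segment between two visible points is straight. -/
lemma joins_of_visible {o p q : X} {g : ℂ → X} (hg : S.IsExp o g) {u v : ℂ}
    (hu : ∀ s : ℝ, 0 ≤ s → s < 1 → (s : ℂ) * u ∈ S.expDom o)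
    (hp : Tendsto (fun s : ℝ => g ((s : ℂ) * u)) (𝓝[<] 1) (𝓝 p))
    (hv : ∀ s : ℝ, 0 ≤ s → s < 1 → (s : ℂ) * v ∈ S.expDom o)
    (hq : Tendsto (fun s : ℝ => g ((s : ℂ) * v)) (𝓝[<] 1) (𝓝 q))
    (hseg : ∀ μ : ℝ, 0 < μ → μ < 1 → ((1 - μ : ℝ) : ℂ) * u + (μ : ℂ) * v ∈ S.expDom o) :
    S.Joins p q (v - u) := by
  set f : ℝ → X := fun μ => g (((1 - μ : ℝ) : ℂ) * u + (μ : ℂ) * v)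
  have hf : ∀ t ∈ Ioo (0 : ℝ) 1, S.DevAt (fun r : ℝ => (r : ℂ) * (v - u)) f t := by
    intro t ht
    have e : ∀ r : ℝ, ((1 - r : ℝ) : ℂ) * u + (r : ℂ) * v = u + r * (v - u) := fun r => by
      push_cast; ring
    have := hg.devAt _ (hseg t ht.1 ht.2)
    rw [e] at this
    simpa only [f, e] using this.line
  have h0 : Tendsto f (𝓝[>] 0) (𝓝 p) := tendsto_corner hg hu hp hseg
  have h1 : Tendsto f (𝓝[<] 1) (𝓝 q) := by
    have := (tendsto_corner (u := v) (v := u) hg hv hq fun μ h0 h1 => by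
      have := hseg (1 - μ) (by linarith) (by linarith)
      rwa [sub_sub_cancel, add_comm] at this).comp tendsto_one_sub_nhdsLT
    refine this.congr fun μ => ?_
    simp only [Function.comp, sub_sub_cancel, f]
    rw [add_comm]
  have hfc : ContinuousOn f (Ioo 0 1) := fun t ht => (hf t ht).continuousAt.continuousWithinAt
  refine ⟨extendFrom (Ioo 0 1) f, continuousOn_Icc_extendFrom_Ioo hfc h0 h1,
    eq_lim_at_left_extendFrom_Ioo one_pos h0, eq_lim_at_right_extendFrom_Ioo one_pos h1, ?_⟩
  intro t ht
  refine (hf t ht).congr ?_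
  filter_upwards [isOpen_Ioo.mem_nhds ht] with r hr
  exact extendFrom_extends hfc r hr

end Ray

/-! ### Vectors of saddle connections in half-infinite strips. -/

section Strip

variable [T2Space X] [CompactSpace X]

/-- If the parallelogram over the base is not contained in the domain of the exponential map, then
the lowest singular point visible in it gives a saddle connection. -/
lemma exists_holonomy_of_exit {o p : X} {g : ℂ → X} (hg : S.IsExp o g) {w d : ℂ}
    (hwd : cross w d ≠ 0)
    (hbase : ∀ x : ℝ, 0 < x → x < 1 → ((x - 1 / 2 : ℝ) : ℂ) * w ∈ S.expDom o) (hps : p ∈ S.sing)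
    (hp : Tendsto (fun s : ℝ => g ((s : ℂ) * (((-1 / 2 : ℝ) : ℂ) * w))) (𝓝[<] 1) (𝓝 p))
    {T x t : ℝ} (hx0 : 0 < x) (hx1 : x < 1) (ht0 : 0 < t) (htT : t ≤ T)
    (hexit : ((x - 1 / 2 : ℝ) : ℂ) * w + (t : ℂ) * d ∉ S.expDom o) :
    ∃ x' t' : ℝ, 0 < x' ∧ x' < 1 ∧ 0 < t' ∧ t' ≤ T ∧
      (x' : ℂ) * w + (t' : ℂ) * d ∈ S.holonomy := by
  have ho : o ∉ S.sing := by
    have h := hbase (1 / 2) (by norm_num) (by norm_num)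
    simp only [sub_self, Complex.ofReal_zero, zero_mul] at h
    have := (hg.devAt 0 h).regular
    rwa [hg.zero] at this
  let ht : ℂ → ℝ := fun z => cross w z / cross w d
  have hht : ∀ a b : ℝ, ht ((a : ℂ) * w + (b : ℂ) * d) = b := by
    intro a b
    simp only [ht]
    rw [div_eq_iff hwd]
    simp [cross]; ring
  let Vis : Set ℂ := {z | z ∉ S.expDom o ∧
    (∀ s : ℝ, 0 ≤ s → s < 1 → (s : ℂ) * z ∈ S.expDom o) ∧
    ∃ x t : ℝ, 0 < x ∧ x < 1 ∧ 0 < t ∧ t ≤ T ∧ z = ((x - 1 / 2 : ℝ) : ℂ) * w + (t : ℂ) * d}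
  have hscale : ∀ s x t : ℝ, (s : ℂ) * (((x - 1 / 2 : ℝ) : ℂ) * w + (t : ℂ) * d) =
      (((s * (x - 1 / 2) + 1 / 2) - 1 / 2 : ℝ) : ℂ) * w + ((s * t : ℝ) : ℂ) * d := by
    intro s x t; push_cast; ring
  -- Moving towards the origin, the midpoint of the base, stays in the strip and lowers the height.
  have hfirst : ∀ x t : ℝ, 0 < x → x < 1 → 0 < t → t ≤ T →
      ((x - 1 / 2 : ℝ) : ℂ) * w + (t : ℂ) * d ∉ S.expDom o → ∃ z ∈ Vis, ht z ≤ t := by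
    intro x t hx0 hx1 ht0 htT hexit
    obtain ⟨s, hs0, hs1, hs, hr⟩ := exists_first_exit ho hexit
    refine ⟨_, ⟨hs, ?_, s * (x - 1 / 2) + 1 / 2, s * t, by nlinarith, by nlinarith, by positivity,
      (mul_le_of_le_one_left ht0.le hs1).trans htT, hscale s x t⟩, ?_⟩
    · intro r hr0 hr1
      have := hr (r * s) (by positivity) (by nlinarith)
      rw [Complex.ofReal_mul, mul_assoc] at this
      exact this
    · rw [hscale, hht]
      exact mul_le_of_le_one_left ht0.le hs1
  have hfin : Vis.Finite := by
    refine (S.finite_sing.biUnion fun q _ =>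
      finite_joins S o q (‖w‖ + T * ‖d‖)).subset ?_
    rintro z ⟨hz1, hz2, x, t, hx0, hx1, ht0, htT, hz⟩
    obtain ⟨q, hq, hlim⟩ := exists_sing_of_exit hg hz2 hz1
    simp only [mem_iUnion]
    refine ⟨q, hq, ?_, ?_⟩
    · rw [hz]
      refine (norm_add_le _ _).trans ?_
      rw [norm_mul, norm_mul, Complex.norm_real, Complex.norm_real, Real.norm_of_nonneg ht0.le]
      refine add_le_add (mul_le_of_le_one_left (norm_nonneg _) ?_)
        (mul_le_mul_of_nonneg_right htT (norm_nonneg _))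
      rw [Real.norm_eq_abs, abs_le]
      constructor <;> linarith
    · have h0 := zero_mem_expDom ho
      have := joins_of_visible (u := 0) (v := z) (p := o) hg (fun s _ _ => by simpa using h0)
        (by simp [hg.zero]) hz2 hlim (fun μ h0 h1 => by simpa using hz2 μ h0.le h1)
      simpa using this
  obtain ⟨z₁, hz₁, -⟩ := hfirst x t hx0 hx1 ht0 htT hexit
  obtain ⟨z, ⟨hz1, hz2, x', t', hx'0, hx'1, ht'0, ht'T, hz⟩, hmin⟩ :=
    hfin.exists_minimalFor ht Vis ⟨z₁, hz₁⟩
  have hbelow : ∀ a b : ℝ, 0 < a → a < 1 → 0 < b → b < t' →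
      ((a - 1 / 2 : ℝ) : ℂ) * w + (b : ℂ) * d ∈ S.expDom o := by
    intro a b ha0 ha1 hb0 hb
    by_contra hcon
    obtain ⟨y, hy, hyb⟩ := hfirst a b ha0 ha1 hb0 (hb.le.trans ht'T) hcon
    have hzt : ht z = t' := by rw [hz, hht]
    have := hmin hy (by rw [hzt]; linarith)
    rw [hzt] at this
    linarith
  obtain ⟨q, hq, hlim⟩ := exists_sing_of_exit hg hz2 hz1
  -- Every open segment point from the left base corner to the lowest visible point `z` is lower
  -- than `z`, hence in the domain by `hbelow`.
  have := joins_of_visible (u := ((-1 / 2 : ℝ) : ℂ) * w) (v := z) hg ?_ hp hz2 hlim ?_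
  · refine ⟨x', t', hx'0, hx'1, ht'0, ht'T, mem_holonomy_iff.2 ⟨p, hps, q, hq, ?_⟩⟩
    have e : z - ((-1 / 2 : ℝ) : ℂ) * w = (x' : ℂ) * w + (t' : ℂ) * d := by
      rw [hz]; push_cast; ring
    rwa [e] at this
  · intro s h0 h1
    have := hbase ((1 - s) / 2) (by linarith) (by linarith)
    convert this using 1
    push_cast; ring
  · intro μ h0 h1
    have := hbelow (μ * x') (μ * t') (by positivity) (by nlinarith) (by positivity) (by nlinarith)
    convert this using 1
    rw [hz]; push_cast; ring

/-- If the half-infinite strip over the base is contained in the domain of the exponential map, then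
by recurrence its two sides are not. -/
lemma exists_exit_of_strip {o p q : X} {g : ℂ → X} (hg : S.IsExp o g) {w d : ℂ}
    (hwd : cross w d ≠ 0)
    (hstrip : ∀ x t : ℝ, 0 < x → x < 1 → 0 ≤ t →
      ((x - 1 / 2 : ℝ) : ℂ) * w + (t : ℂ) * d ∈ S.expDom o)
    (hps : p ∈ S.sing) (hqs : q ∈ S.sing)
    (hp : Tendsto (fun x : ℝ => g (((x - 1 / 2 : ℝ) : ℂ) * w)) (𝓝[>] 0) (𝓝 p))
    (hq : Tendsto (fun x : ℝ => g (((x - 1 / 2 : ℝ) : ℂ) * w)) (𝓝[<] 1) (𝓝 q)) :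
    ∃ T : ℝ, 0 < T ∧ ((0 - 1 / 2 : ℝ) : ℂ) * w + (T : ℂ) * d ∉ S.expDom o ∧
      ((1 - 1 / 2 : ℝ) : ℂ) * w + (T : ℂ) * d ∉ S.expDom o := by
  let Z : ℝ × ℝ → ℂ := fun y => ((y.1 - 1 / 2 : ℝ) : ℂ) * w + (y.2 : ℂ) * d
  have hZc : Continuous Z := by fun_prop
  let cw : ℂ → ℝ := fun z => cross z d / cross w d
  let cd : ℂ → ℝ := fun z => cross w z / cross w d
  have hcw : Continuous cw := by simp only [cw, cross]; fun_prop
  have hcd : Continuous cd := by simp only [cd, cross]; fun_prop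
  have hdecomp : ∀ z, z = (cw z : ℂ) * w + (cd z : ℂ) * d := by
    intro z
    have e1 : cw z * cross w d = cross z d := div_mul_cancel₀ _ hwd
    have e2 : cd z * cross w d = cross w z := div_mul_cancel₀ _ hwd
    apply Complex.ext <;> apply mul_right_cancel₀ hwd
    · have e3 : z.re * cross w d = cross z d * w.re + cross w z * d.re := by
        simp only [cross]; ring
      rw [Complex.add_re, Complex.re_ofReal_mul, Complex.re_ofReal_mul]
      linear_combination e3 - w.re * e1 - d.re * e2
    · have e3 : z.im * cross w d = cross z d * w.im + cross w z * d.im := by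
        simp only [cross]; ring
      rw [Complex.add_im, Complex.im_ofReal_mul, Complex.im_ofReal_mul]
      linear_combination e3 - w.im * e1 - d.im * e2
  -- two points of the strip with the same image
  obtain ⟨P₁, P₂, h11, h12, h13, h21, h22, h12', hg12⟩ : ∃ P₁ P₂ : ℝ × ℝ, 0 < P₁.1 ∧ P₁.1 < 1 ∧
      0 ≤ P₁.2 ∧ 0 < P₂.1 ∧ P₂.1 < 1 ∧ P₁.2 < P₂.2 ∧ g (Z P₁) = g (Z P₂) := by
    obtain ⟨c, hc⟩ : ∃ c, MapClusterPt c atTop (fun k : ℕ => g (Z (1 / 2, k + 1))) :=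
      exists_clusterPt_of_compactSpace _
    let K : S.ConeChart c := Classical.arbitrary _
    have hρ := K.ρ_pos
    have hsmall : ∀ᶠ f : ℂ in 𝓝 0, |cw f| < 1 / 2 ∧ |cd f| < 1 / 2 := by
      have e1 : cw 0 = 0 := by simp [cw, cross]
      have e2 : cd 0 = 0 := by simp [cd, cross]
      refine ((hcw.abs.tendsto 0).eventually (gt_mem_nhds ?_)).and
        ((hcd.abs.tendsto 0).eventually (gt_mem_nhds ?_)) <;> simp [e1, e2]
    obtain ⟨r, hr, hrb⟩ := Metric.eventually_nhds_iff.1 hsmall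
    -- When the midline passes near the cluster point `c`, with value `f` of the primitive, a step
    -- by `-f` lands exactly on `c`; it changes each strip coordinate by less than 1/2.
    have hret : ∃ᶠ k : ℕ in atTop, ∃ P : ℝ × ℝ, 0 < P.1 ∧ P.1 < 1 ∧ |P.2 - (k + 1)| < 1 / 2 ∧
        g (Z P) = c := by
      refine (hc.frequently (K.nhd_mem_nhds (r := min r (K.ρ / 2)) (by positivity))).mono ?_
      rintro k ⟨hk1, hk2⟩
      set f := K.F (g (Z (1 / 2, k + 1))) with hf
      have hkr : ‖f‖ < r := hk2.trans_le (min_le_left _ _)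
      have hkρ : ‖f‖ < K.ρ / 2 := hk2.trans_le (min_le_right _ _)
      obtain ⟨h1, h2⟩ := hrb (by simpa using hkr)
      rw [abs_lt] at h1 h2
      have hpt : ∀ t : ℝ, Z (1 / 2, k + 1) + (t : ℂ) * (-f) =
          Z (1 / 2 - t * cw f, k + 1 - t * cd f) := by
        intro t
        conv_lhs => rw [hdecomp f]
        simp only [Z]; push_cast; ring
      have hseg := K.F_segment (g := g) (u := Z (1 / 2, k + 1)) (v := -f) ?_ hk1
        (by rw [norm_neg, ← hf]; linarith)
      · have e := hpt 1
        rw [Complex.ofReal_one, one_mul] at e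
        rw [← hf, add_neg_cancel] at hseg
        refine ⟨(1 / 2 - 1 * cw f, k + 1 - 1 * cd f), by simp; linarith, by simp; linarith, ?_, ?_⟩
        · rw [abs_lt]; constructor <;> simp <;> linarith
        · rw [← e]
          exact K.eq_center hseg.1 hseg.2
      · intro t ht
        rw [hpt]
        refine hg.devAt _ (hstrip _ _ ?_ ?_ ?_)
        · nlinarith [ht.1, ht.2]
        · nlinarith [ht.1, ht.2]
        · have : (0 : ℝ) ≤ k := by positivity
          nlinarith [ht.1, ht.2]
    obtain ⟨k₁, -, P₁, a1, a2, a3, a4⟩ := (Filter.frequently_atTop.1 hret) 0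
    -- The nominal heights differ by at least 1 and each error is below 1/2, so `P₂` is strictly
    -- higher.
    obtain ⟨k₂, hk, P₂, b1, b2, b3, b4⟩ := (Filter.frequently_atTop.1 hret) (k₁ + 1)
    rw [abs_lt] at a3 b3
    have hk' : (k₁ : ℝ) + 1 ≤ k₂ := by exact_mod_cast hk
    have hk0 : (0 : ℝ) ≤ k₁ := by positivity
    exact ⟨P₁, P₂, a1, a2, by linarith, b1, b2, by linarith, a4.trans b4.symm⟩
  set δ := P₂.1 - P₁.1 with hδ
  set T := P₂.2 - P₁.2 with hT
  have hT0 : 0 < T := by linarith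
  -- invariance under the translation by `(δ, T)`
  have hinv : EqOn (g ∘ Z) (g ∘ fun y => Z (y + (δ, T)))
      (Ioo 0 1 ×ˢ Ici 0 ∩ {y | y.1 + δ ∈ Ioo (0 : ℝ) 1}) := by
    have hconv : Convex ℝ ((Ioo 0 1 ×ˢ Ici 0 : Set (ℝ × ℝ)) ∩ {y | y.1 + δ ∈ Ioo (0 : ℝ) 1}) := by
      refine ((convex_Ioo 0 1).prod (convex_Ici 0)).inter ?_
      intro y hy y' hy' a b ha hb hab
      have := convex_Ioo (0 : ℝ) 1 hy hy' ha hb hab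
      simp only [smul_eq_mul] at this
      show (a • y + b • y').1 + δ ∈ Ioo (0 : ℝ) 1
      have e : (a • y + b • y').1 + δ = a * (y.1 + δ) + b * (y'.1 + δ) := by
        simp; linear_combination (-δ) * hab
      rwa [e]
    refine DevAt.eqOn (S := S) (D := Z) hconv.isPreconnected (z₀ := P₁) ?_ ?_ ?_ ?_
    · rintro y ⟨⟨hy1, hy2⟩, hy3⟩
      exact DevAt.comp (k := Z) (hg.devAt _ (hstrip _ _ hy1.1 hy1.2 hy2)) hZc.continuousAt
    · rintro y ⟨⟨hy1, hy2⟩, hy3⟩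
      have hy2 : (0 : ℝ) ≤ y.2 := hy2
      refine (DevAt.comp (k := fun y => Z (y + (δ, T)))
        (hg.devAt _ (hstrip _ _ hy3.1 hy3.2 (by simp; linarith))) (by fun_prop)).congr_dev ?_
      intro y'
      simp [Z]; ring
    · exact ⟨⟨⟨h11, h12⟩, h13⟩, by simp [hδ, h21, h22]⟩
    · have : P₁ + (δ, T) = P₂ := by ext <;> simp [hδ, hT]
      simp only [Function.comp, this, hg12]
  have hshift : ∀ x : ℝ, 0 < x → x < 1 → 0 < x + δ → x + δ < 1 →
      g (Z (x + δ, T)) = g (((x - 1 / 2 : ℝ) : ℂ) * w) := by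
    intro x a b c e
    have := hinv ⟨⟨(⟨a, b⟩ : (x, (0 : ℝ)).1 ∈ Ioo (0 : ℝ) 1), mem_Ici.2 le_rfl⟩, ⟨c, e⟩⟩
    simp only [Function.comp, Prod.mk_add_mk, zero_add] at this
    rw [← this]
    simp [Z]
  -- The shift carries the singular end of the base to height `T`, which therefore cannot be in the
  -- domain.
  have hside : ∀ (x₀ : ℝ) (l : Filter ℝ) [l.NeBot] (c : X), c ∈ S.sing → l ≤ 𝓝 x₀ →
      Tendsto (fun x : ℝ => g (((x - 1 / 2 : ℝ) : ℂ) * w)) l (𝓝 c) →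
      (∀ᶠ x in l, 0 < x ∧ x < 1 ∧ 0 < x + δ ∧ x + δ < 1) → Z (x₀ + δ, T) ∉ S.expDom o := by
    intro x₀ l _ c hc hl hlim hev hmem
    have h1 : ContinuousAt (fun x => g (Z (x + δ, T))) x₀ :=
      ContinuousAt.comp (f := fun x => Z (x + δ, T)) (hg.devAt _ hmem).continuousAt (by fun_prop)
    have h2 : Tendsto (fun x => g (Z (x + δ, T))) l (𝓝 c) :=
      hlim.congr' (hev.mono fun x h => (hshift x h.1 h.2.1 h.2.2.1 h.2.2.2).symm)
    exact (hg.devAt _ hmem).regular (tendsto_nhds_unique (h1.tendsto.mono_left hl) h2 ▸ hc)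
  have hleft : 0 ≤ δ → Z (0 + δ, T) ∉ S.expDom o := fun h =>
    hside 0 (𝓝[>] 0) p hps nhdsWithin_le_nhds hp (by
      filter_upwards [Ioo_mem_nhdsGT (show (0 : ℝ) < 1 - δ by linarith)] with x hx
      exact ⟨hx.1, by linarith [hx.2], by linarith [hx.1], by linarith [hx.2]⟩)
  have hright : δ ≤ 0 → Z (1 + δ, T) ∉ S.expDom o := fun h =>
    hside 1 (𝓝[<] 1) q hqs nhdsWithin_le_nhds hq (by
      filter_upwards [Ioo_mem_nhdsLT (show (-δ : ℝ) < 1 by linarith)] with x hx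
      exact ⟨by linarith [hx.1], by linarith [hx.2], by linarith [hx.1], by linarith [hx.2]⟩)
  -- A nonzero horizontal shift would put such a singular point into the open strip.
  have hδ0 : δ = 0 := by
    rcases lt_trichotomy δ 0 with h | h | h
    · exact absurd (hstrip _ _ (by linarith) (by linarith) hT0.le) (hright h.le)
    · exact h
    · exact absurd (hstrip _ _ (by linarith) (by linarith) hT0.le) (hleft h.le)
  have h0 := hleft hδ0.ge
  have h1 := hright hδ0.le
  rw [hδ0, add_zero] at h0 h1
  exact ⟨T, hT0, h0, h1⟩

/-- Every half-infinite strip over a saddle connection, with either one of its sides, contains the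
vector of a saddle connection. -/
theorem exists_holonomy_in_strip {w d : ℂ} (hw : w ∈ S.holonomy) (hwd : cross w d ≠ 0) :
    (∃ x t : ℝ, 0 ≤ x ∧ x < 1 ∧ 0 < t ∧ (x : ℂ) * w + (t : ℂ) * d ∈ S.holonomy) ∧
    ∃ x t : ℝ, 0 < x ∧ x ≤ 1 ∧ 0 < t ∧ (x : ℂ) * w + (t : ℂ) * d ∈ S.holonomy := by
  obtain ⟨σ, hσ⟩ := hw
  obtain ⟨g, hg⟩ := S.exists_isExp (σ (1 / 2))
  have hray : ∀ e : ℝ, |e| ≤ 1 / 2 → ∀ s ∈ Ico (0 : ℝ) 1,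
      (s : ℂ) * ((e : ℂ) * w) ∈ S.expDom (σ (1 / 2)) ∧
        g ((s : ℂ) * ((e : ℂ) * w)) = σ (1 / 2 + s * e) := by
    intro e he
    rw [abs_le] at he
    refine exp_ray (γ := fun s => σ (1 / 2 + s * e)) hg (by simp) fun s hs => ?_
    refine (DevAt.comp (k := fun s : ℝ => 1 / 2 + s * e) (hσ.devAt ⟨?_, ?_⟩)
      (by fun_prop)).congr_dev ?_
    · nlinarith [hs.1, hs.2]
    · nlinarith [hs.1, hs.2]
    · intro s'; simp; ring
  have hbase : ∀ x : ℝ, 0 < x → x < 1 → ((x - 1 / 2 : ℝ) : ℂ) * w ∈ S.expDom (σ (1 / 2)) ∧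
      g (((x - 1 / 2 : ℝ) : ℂ) * w) = σ x := by
    intro x h0 h1
    rcases le_total x (1 / 2) with hx | hx
    · have := hray (-1 / 2) (by norm_num [abs_le]) (1 - 2 * x) ⟨by linarith, by linarith⟩
      have e1 : ((1 - 2 * x : ℝ) : ℂ) * (((-1 / 2 : ℝ) : ℂ) * w) = ((x - 1 / 2 : ℝ) : ℂ) * w := by
        push_cast; ring
      have e2 : 1 / 2 + (1 - 2 * x) * (-1 / 2) = x := by ring
      rwa [e1, e2] at this
    · have := hray (1 / 2) (by norm_num [abs_le]) (2 * x - 1) ⟨by linarith, by linarith⟩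
      have e1 : ((2 * x - 1 : ℝ) : ℂ) * (((1 / 2 : ℝ) : ℂ) * w) = ((x - 1 / 2 : ℝ) : ℂ) * w := by
        push_cast; ring
      have e2 : 1 / 2 + (2 * x - 1) * (1 / 2) = x := by ring
      rwa [e1, e2] at this
  have hσ0 : Tendsto σ (𝓝[>] 0) (𝓝 (σ 0)) :=
    ((hσ.continuousOn 0 (by simp)).mono Ioc_subset_Icc_self).tendsto.mono_left
      (by rw [nhdsWithin_Ioc_eq_nhdsGT one_pos])
  have hσ1 : Tendsto σ (𝓝[<] 1) (𝓝 (σ 1)) :=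
    ((hσ.continuousOn 1 (by simp)).mono Ico_subset_Icc_self).tendsto.mono_left
      (by rw [nhdsWithin_Ico_eq_nhdsLT one_pos])
  have hlim0 : Tendsto (fun x : ℝ => g (((x - 1 / 2 : ℝ) : ℂ) * w)) (𝓝[>] 0) (𝓝 (σ 0)) := by
    refine hσ0.congr' ?_
    filter_upwards [Ioo_mem_nhdsGT one_pos] with x hx
    exact (hbase x hx.1 hx.2).2.symm
  have hlim1 : Tendsto (fun x : ℝ => g (((x - 1 / 2 : ℝ) : ℂ) * w)) (𝓝[<] 1) (𝓝 (σ 1)) := by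
    refine hσ1.congr' ?_
    filter_upwards [Ioo_mem_nhdsLT one_pos] with x hx
    exact (hbase x hx.1 hx.2).2.symm
  have hlimr : Tendsto (fun s : ℝ => g ((s : ℂ) * (((-1 / 2 : ℝ) : ℂ) * w))) (𝓝[<] 1)
      (𝓝 (σ 0)) := by
    have h : Tendsto (fun s : ℝ => (1 - s) / 2) (𝓝[<] 1) (𝓝[>] 0) := by
      refine tendsto_nhdsWithin_iff.2 ⟨?_, ?_⟩
      · have : Tendsto (fun s : ℝ => (1 - s) / 2) (𝓝[<] 1) (𝓝 ((1 - 1) / 2)) :=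
          Continuous.continuousWithinAt (by fun_prop)
        simpa using this
      · filter_upwards [self_mem_nhdsWithin] with s hs
        have : s < 1 := hs
        show 0 < (1 - s) / 2
        linarith
    refine (hlim0.comp h).congr fun s => ?_
    simp only [Function.comp]
    congr 1
    push_cast; ring
  have hexit := fun (d : ℂ) (hwd : cross w d ≠ 0) (T x t : ℝ) =>
    exists_holonomy_of_exit (T := T) (x := x) (t := t) hg hwd (fun x h0 h1 => (hbase x h0 h1).1)
      hσ.start hlimr
  -- An exit in the open strip gives a vector with `0 < x < 1`, which serves both claims; otherwise
  -- recurrence applies.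
  by_cases hstrip : ∀ x t : ℝ, 0 < x → x < 1 → 0 ≤ t →
      ((x - 1 / 2 : ℝ) : ℂ) * w + (t : ℂ) * d ∈ S.expDom (σ (1 / 2))
  swap
  · push Not at hstrip
    obtain ⟨x, t, hx0, hx1, ht0, hxt⟩ := hstrip
    have ht : 0 < t := ht0.lt_of_ne fun h => hxt (by
      rw [← h]; simpa using (hbase x hx0 hx1).1)
    obtain ⟨x', t', a1, a2, a3, -, a4⟩ := hexit d hwd t x t hx0 hx1 ht le_rfl hxt
    exact ⟨⟨x', t', a1.le, a2, a3, a4⟩, ⟨x', t', a1, a2.le, a3, a4⟩⟩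
  obtain ⟨T, hT, hT0, hT1⟩ := exists_exit_of_strip hg hwd hstrip hσ.start hσ.finish hlim0 hlim1
  -- Tilting `d` to d - κεw moves the exit point on the side `x₀` into the open strip. The resulting
  -- vectors have bounded length, so by finiteness one of them serves for arbitrarily small ε.
  have hperturb : ∀ κ : ℝ, ∀ x₀ : ℝ, (κ = 1 ∧ x₀ = 0) ∨ (κ = -1 ∧ x₀ = 1) →
      ((x₀ - 1 / 2 : ℝ) : ℂ) * w + (T : ℂ) * d ∉ S.expDom (σ (1 / 2)) →
      ∃ x t : ℝ, 0 < t ∧ (x : ℂ) * w + (t : ℂ) * d ∈ S.holonomy ∧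
        ∃ᶠ ε in 𝓝[>] (0 : ℝ), 0 < x + κ * ε * t ∧ x + κ * ε * t < 1 := by
    intro κ x₀ hκ hout
    have hev : ∀ᶠ ε : ℝ in 𝓝[>] 0, ∃ v ∈ {v | ‖v‖ ≤ 2 * ‖w‖ + T * ‖d‖ ∧ v ∈ S.holonomy},
        ∃ x t : ℝ, 0 < t ∧ v = (x : ℂ) * w + (t : ℂ) * d ∧ 0 < x + κ * ε * t ∧
          x + κ * ε * t < 1 := by
      filter_upwards [Ioo_mem_nhdsGT (show 0 < 1 / T by positivity)] with ε hε
      have hεT : ε * T < 1 := by have := hε.2; rwa [lt_div_iff₀ hT] at this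
      have hεT0 : 0 < ε * T := mul_pos hε.1 hT
      set d' : ℂ := d - ((κ * ε : ℝ) : ℂ) * w with hd'
      have hwd' : cross w d' ≠ 0 := by
        have : cross w d' = cross w d := by simp [cross, d']; ring
        rwa [this]
      obtain ⟨x', t', a1, a2, a3, a4, a5⟩ := hexit d' hwd' T (x₀ + κ * ε * T) T
        (by rcases hκ with ⟨rfl, rfl⟩ | ⟨rfl, rfl⟩ <;> linarith)
        (by rcases hκ with ⟨rfl, rfl⟩ | ⟨rfl, rfl⟩ <;> linarith) hT le_rfl (by
          convert hout using 2
          rw [hd']; push_cast; ring)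
      have e : (x' : ℂ) * w + (t' : ℂ) * d' =
          ((x' - κ * ε * t' : ℝ) : ℂ) * w + (t' : ℂ) * d := by
        rw [hd']; push_cast; ring
      have hεt : ε * t' ≤ 1 := (mul_le_mul_of_nonneg_left a4 hε.1.le).trans hεT.le
      have hεt0 : 0 < ε * t' := mul_pos hε.1 a3
      rw [e] at a5
      refine ⟨_, ⟨?_, a5⟩, x' - κ * ε * t', t', a3, rfl, by linarith, by linarith⟩
      refine (norm_add_le _ _).trans ?_
      rw [norm_mul, norm_mul, Complex.norm_real, Complex.norm_real, Real.norm_of_nonneg a3.le]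
      refine add_le_add (mul_le_mul_of_nonneg_right ?_ (norm_nonneg _))
        (mul_le_mul_of_nonneg_right a4 (norm_nonneg _))
      rw [Real.norm_eq_abs, abs_le]
      rcases hκ with ⟨rfl, rfl⟩ | ⟨rfl, rfl⟩ <;> constructor <;> linarith
    by_contra! hcon
    have hall : ∀ v ∈ {v | ‖v‖ ≤ 2 * ‖w‖ + T * ‖d‖ ∧ v ∈ S.holonomy}, ∀ᶠ ε : ℝ in 𝓝[>] 0,
        ¬ ∃ x t : ℝ, 0 < t ∧ v = (x : ℂ) * w + (t : ℂ) * d ∧ 0 < x + κ * ε * t ∧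
          x + κ * ε * t < 1 := by
      rintro v ⟨-, hv⟩
      by_cases hxt : ∃ x t : ℝ, 0 < t ∧ v = (x : ℂ) * w + (t : ℂ) * d
      · obtain ⟨x, t, ht, rfl⟩ := hxt
        filter_upwards [hcon x t ht hv] with ε hε
        rintro ⟨x', t', ht', e, h1, h2⟩
        have et : t = t' := by
          have := congrArg (cross w) e
          have h3 : ∀ a b : ℝ, cross w ((a : ℂ) * w + (b : ℂ) * d) = b * cross w d := by
            intro a b; simp [cross]; ring
          rw [h3, h3] at this
          exact mul_right_cancel₀ hwd this
        have ex : x = x' := by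
          have := congrArg (fun z => cross z d) e
          have h3 : ∀ a b : ℝ, cross ((a : ℂ) * w + (b : ℂ) * d) d = a * cross w d := by
            intro a b; simp [cross]; ring
          simp only [h3] at this
          exact mul_right_cancel₀ hwd this
        subst et ex
        exact not_le.2 h2 (hε h1)
      · exact Filter.Eventually.of_forall fun ε ⟨x, t, ht, e, _⟩ => hxt ⟨x, t, ht, e⟩
    have := (Filter.eventually_all_finite (S.finite_holonomy _)).2 hall
    obtain ⟨ε, ⟨v, hv, h⟩, h'⟩ := (hev.and this).exists
    exact h' v hv h
  have hfar : ∀ x t κ : ℝ, ∀ U : Set ℝ, IsOpen U → x ∈ U →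
      (∃ᶠ ε in 𝓝[>] (0 : ℝ), 0 < x + κ * ε * t ∧ x + κ * ε * t < 1) →
      ∃ ε, 0 < ε ∧ x + κ * ε * t ∈ U ∧ 0 < x + κ * ε * t ∧ x + κ * ε * t < 1 := by
    intro x t κ U hU hx hf
    have h1 : Tendsto (fun ε : ℝ => x + κ * ε * t) (𝓝[>] 0) (𝓝 (x + κ * 0 * t)) :=
      Continuous.continuousWithinAt (by fun_prop)
    simp only [mul_zero, zero_mul, add_zero] at h1
    obtain ⟨ε, h2, h3, h4⟩ :=
      (hf.and_eventually ((h1.eventually (hU.mem_nhds hx)).and self_mem_nhdsWithin)).exists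
    exact ⟨ε, h4, h3, h2⟩
  -- Letting ε tend to 0 gives 0 ≤ x ≤ 1; the sign of κ makes the inequality strict at the opposite
  -- side.
  constructor
  · obtain ⟨x, t, ht, hv, hf⟩ := hperturb 1 0 (Or.inl ⟨rfl, rfl⟩) hT0
    refine ⟨x, t, ?_, ?_, ht, hv⟩
    · by_contra! hx
      obtain ⟨ε, -, h1, h2, -⟩ := hfar x t 1 (Iio 0) isOpen_Iio hx hf
      exact absurd h1 (not_lt.2 h2.le)
    · obtain ⟨ε, h0, -, -, h1⟩ := hfar x t 1 univ isOpen_univ trivial hf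
      have := mul_pos h0 ht
      linarith
  · obtain ⟨x, t, ht, hv, hf⟩ := hperturb (-1) 1 (Or.inr ⟨rfl, rfl⟩) hT1
    refine ⟨x, t, ?_, ?_, ht, hv⟩
    · obtain ⟨ε, h0, -, h1, -⟩ := hfar x t (-1) univ isOpen_univ trivial hf
      have := mul_pos h0 ht
      linarith
    · by_contra! hx
      obtain ⟨ε, -, h1, -, h2⟩ := hfar x t (-1) (Ioi 1) isOpen_Ioi hx hf
      exact absurd h1 (not_lt.2 h2.le)

end Strip

end TranslationSurface

end Slopes

/-! ### The order on candidates and the algorithm. -/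

namespace Slopes

/-- `v` is the element of `K` with the largest ratio `x / y` and, among those, with the least
`y`-component. -/
def IsBest (K : Set ℂ) (v : ℂ) : Prop :=
  v ∈ K ∧ ∀ u ∈ K, u.re / u.im < v.re / v.im ∨ (u.re / u.im = v.re / v.im ∧ v.im ≤ u.im)

lemma IsBest.unique {K : Set ℂ} (hK : ∀ u ∈ K, 0 < u.im) {v v' : ℂ} (h : IsBest K v)
    (h' : IsBest K v') : v = v' := by
  have h1 := h.2 v' h'.1
  have h2 := h'.2 v h.1
  have him : v.im = v'.im := by
    rcases h1 with h1 | ⟨h1, h1'⟩ <;> rcases h2 with h2 | ⟨h2, h2'⟩ <;> linarith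
  have hr : v.re / v.im = v'.re / v'.im := by
    rcases h1 with h1 | ⟨h1, h1'⟩ <;> rcases h2 with h2 | ⟨h2, h2'⟩ <;> linarith
  rw [him] at hr
  exact Complex.ext ((div_left_inj' (hK _ h'.1).ne').1 hr) him

/-- Only competitors at least as good as `u₀` matter; among these finitely many the ratio is
maximized first, then the height minimized. -/
lemma exists_isBest {K : Set ℂ} {u₀ : ℂ} (hu₀ : u₀ ∈ K)
    (hfin : {u | u ∈ K ∧ (u₀.re / u₀.im < u.re / u.im ∨
      (u.re / u.im = u₀.re / u₀.im ∧ u.im ≤ u₀.im))}.Finite) : ∃ v, IsBest K v := by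
  set B := {u | u ∈ K ∧ (u₀.re / u₀.im < u.re / u.im ∨
      (u.re / u.im = u₀.re / u₀.im ∧ u.im ≤ u₀.im))}
  have hu₀B : u₀ ∈ B := ⟨hu₀, Or.inr ⟨rfl, le_rfl⟩⟩
  obtain ⟨v₁, hv₁, hmax⟩ := B.exists_max_image (fun u => u.re / u.im) hfin ⟨u₀, hu₀B⟩
  obtain ⟨v, ⟨hvB, hv⟩, hmin⟩ := (B ∩ {u | u.re / u.im = v₁.re / v₁.im}).exists_min_image
    (fun u => u.im) (hfin.subset inter_subset_left) ⟨v₁, hv₁, rfl⟩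
  have hv : v.re / v.im = v₁.re / v₁.im := hv
  refine ⟨v, hvB.1, fun u hu => ?_⟩
  have h0 : u₀.re / u₀.im ≤ v.re / v.im := hv ▸ hmax u₀ hu₀B
  by_cases huB : u ∈ B
  · rcases (hmax u huB).lt_or_eq with h | h
    · exact Or.inl (hv ▸ h)
    · exact Or.inr ⟨h.trans hv.symm, hmin u ⟨huB, h⟩⟩
  · have hcase : u.re / u.im < u₀.re / u₀.im ∨ (u.re / u.im = u₀.re / u₀.im ∧ u₀.im < u.im) := by
      by_contra! hcon
      rcases hcon.1.lt_or_eq with h | h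
      · exact huB ⟨hu, Or.inl h⟩
      · exact huB ⟨hu, Or.inr ⟨h.symm, hcon.2 h.symm⟩⟩
    rcases hcase with h | ⟨h, h'⟩
    · exact Or.inl (h.trans_le h0)
    · rcases h0.lt_or_eq with h1 | h1
      · exact Or.inl (h ▸ h1)
      · refine Or.inr ⟨h.trans h1, ?_⟩
        exact (hmin u₀ ⟨hu₀B, (h1.trans hv)⟩).trans h'.le

lemma norm_le_norm_iff_of_ratio_eq {u v : ℂ} (hu : 0 < u.im) (hv : 0 < v.im)
    (h : u.re / u.im = v.re / v.im) : ‖v‖ ≤ ‖u‖ ↔ v.im ≤ u.im := by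
  have e : v = ((v.im / u.im : ℝ) : ℂ) * u := by
    rw [div_eq_div_iff hu.ne' hv.ne'] at h
    apply Complex.ext
    · rw [Complex.re_ofReal_mul, div_mul_eq_mul_div, eq_div_iff hu.ne']
      linear_combination -h
    · rw [Complex.im_ofReal_mul, div_mul_cancel₀ _ hu.ne']
  have hpos : 0 < ‖u‖ := norm_pos_iff.2 fun h0 => by simp [h0] at hu
  have en : ‖v‖ = v.im / u.im * ‖u‖ := by
    conv_lhs => rw [e]
    rw [norm_mul, Complex.norm_real, Real.norm_of_nonneg (by positivity)]
  rw [en, mul_le_iff_le_one_left hpos, div_le_one hu]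

lemma isLeftWinner_iff {Λ : Set ℂ} {p : ℝ × ℝ} {v : ℂ} :
    IsLeftWinner Λ p v ↔ IsBest {u | IsLeftCandidate Λ p u} v := by
  refine and_congr_right fun hv => forall₂_congr fun u hu => or_congr Iff.rfl
    (and_congr_right fun h => norm_le_norm_iff_of_ratio_eq hu.2.1 hv.2.1 h)

/-- The matrix turns a ratio r = x/y into b (b r - a), which increases with r, and divides heights
by b. The order by slope is thus the same at all points. -/
lemma isWinner_iff {Λ : Set ℂ} {p : ℝ × ℝ} (hp : 0 < p.2) {v : ℂ} :
    IsWinner Λ p v ↔ IsBest {u | IsCandidate Λ p u} v := by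
  have him : ∀ u : ℂ, (planeMap (pointMatrix p) u).im = u.im / p.2 := fun u => by
    simp [planeMap, pointMatrix]; ring
  have hre : ∀ u : ℂ, (planeMap (pointMatrix p) u).re = p.2 * u.re - p.1 * u.im := fun u => by
    simp [planeMap, pointMatrix]; ring
  have hratio : ∀ u : ℂ, 0 < u.im → (planeMap (pointMatrix p) u).re /
      (planeMap (pointMatrix p) u).im = p.2 * (p.2 * (u.re / u.im) - p.1) := fun u hu => by
    rw [him, hre]; field_simp
  have hslope : ∀ u : ℂ, slope (planeMap (pointMatrix p) u) =
      ((planeMap (pointMatrix p) u).re / (planeMap (pointMatrix p) u).im)⁻¹ := fun u => by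
    rw [slope, inv_div]
  have hpos : ∀ u : ℂ, IsCandidate Λ p u → 0 < (planeMap (pointMatrix p) u).re /
      (planeMap (pointMatrix p) u).im := fun u hu => by
    rw [him, hre]; exact div_pos hu.2.2.1 (div_pos hu.2.1 hp)
  refine and_congr_right fun hv => forall₂_congr fun u hu => ?_
  have hlt : ∀ u v : ℂ, IsCandidate Λ p u → IsCandidate Λ p v →
      ((planeMap (pointMatrix p) u).re / (planeMap (pointMatrix p) u).im <
      (planeMap (pointMatrix p) v).re / (planeMap (pointMatrix p) v).im ↔
      u.re / u.im < v.re / v.im) := by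
    intro u v hu hv
    rw [hratio u hu.2.1, hratio v hv.2.1, mul_lt_mul_iff_right₀ hp, sub_lt_sub_iff_right,
      mul_lt_mul_iff_right₀ hp]
  have heq : (planeMap (pointMatrix p) u).re / (planeMap (pointMatrix p) u).im =
      (planeMap (pointMatrix p) v).re / (planeMap (pointMatrix p) v).im ↔
      u.re / u.im = v.re / v.im := by
    rw [hratio u hu.2.1, hratio v hv.2.1, mul_right_inj' hp.ne', sub_left_inj,
      mul_right_inj' hp.ne']
  rw [hslope, hslope, inv_lt_inv₀ (hpos v hv) (hpos u hu), hlt u v hu hv, inv_inj, eq_comm, heq]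
  refine or_congr Iff.rfl (and_congr_right fun h => ?_)
  rw [norm_le_norm_iff_of_ratio_eq (by rw [him]; exact div_pos hu.2.1 hp)
    (by rw [him]; exact div_pos hv.2.1 hp) (heq.2 h), him, him, div_le_div_iff_of_pos_right hp]

section Order

variable {Λ : Set ℂ}

lemma finite_near (hfin : ∀ R : ℝ, {v | ‖v‖ ≤ R ∧ v ∈ Λ}.Finite) (a Y M : ℝ) :
    {u | u ∈ Λ ∧ 0 < u.im ∧ u.im ≤ Y ∧ |u.re - a * u.im| ≤ M}.Finite := by
  refine (hfin (M + |a| * Y + Y)).subset ?_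
  rintro u ⟨h1, h2, h3, h4⟩
  refine ⟨?_, h1⟩
  have e1 := Complex.norm_le_abs_re_add_abs_im u
  have e2 : |u.re| ≤ |u.re - a * u.im| + |a * u.im| := by
    simpa using abs_add_le (u.re - a * u.im) (a * u.im)
  rw [abs_mul, abs_of_pos h2] at e2
  rw [abs_of_pos h2] at e1
  have := mul_le_mul_of_nonneg_left h3 (abs_nonneg a)
  linarith

lemma sub_eq_ratio {u : ℂ} (hu : 0 < u.im) (a b : ℝ) :
    b * u.re - a * u.im = (b * (u.re / u.im) - a) * u.im := by
  field_simp

lemma exists_best_left (hfin : ∀ R : ℝ, {v | ‖v‖ ≤ R ∧ v ∈ Λ}.Finite) {a : ℝ}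
    (h : ∃ v, IsLeftCandidate Λ (a, 1) v) : ∃ v, IsBest {u | IsLeftCandidate Λ (a, 1) u} v := by
  have hval : ∀ u, IsLeftCandidate Λ (a, 1) u →
      0 ≤ (u.re / u.im - a) * u.im ∧ (u.re / u.im - a) * u.im < 1 := by
    rintro u ⟨-, h1, h2, h3⟩
    have e := sub_eq_ratio h1 a 1
    rw [one_mul, one_mul] at e
    simp only [one_mul, e] at h2 h3
    exact ⟨h2, h3⟩
  have hbd : ∀ Y, {u | IsLeftCandidate Λ (a, 1) u ∧ u.im ≤ Y}.Finite := by
    intro Y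
    refine (finite_near hfin a Y 1).subset ?_
    rintro u ⟨⟨h1, h2, h3, h4⟩, h5⟩
    simp only [one_mul] at h3 h4
    exact ⟨h1, h2, h5, by rw [abs_of_nonneg h3]; exact h4.le⟩
  -- A ratio r > a bounds the height of anything at least as good by 1/(r - a). Otherwise all
  -- candidates have ratio exactly `a`, and the tie-break bounds the height.
  by_cases hpos : ∃ u, IsLeftCandidate Λ (a, 1) u ∧ a < u.re / u.im
  · obtain ⟨u₀, hu₀, hau⟩ := hpos
    refine exists_isBest hu₀ ((hbd (1 / (u₀.re / u₀.im - a))).subset ?_)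
    rintro u ⟨hu, hor⟩
    refine ⟨hu, ?_⟩
    have hle : u₀.re / u₀.im ≤ u.re / u.im := by
      rcases hor with h | h
      · exact h.le
      · exact h.1.ge
    rw [le_div_iff₀ (by linarith)]
    have := mul_le_mul_of_nonneg_right (sub_le_sub_right hle a) hu.2.1.le
    linarith [(hval u hu).2]
  · push Not at hpos
    obtain ⟨u₀, hu₀⟩ := h
    refine exists_isBest hu₀ ((hbd u₀.im).subset ?_)
    rintro u ⟨hu, hor⟩
    refine ⟨hu, ?_⟩
    rcases hor with h | h
    · have h1 := hpos u hu
      have h2 := nonneg_of_mul_nonneg_left (hval u₀ hu₀).1 hu₀.2.1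
      linarith
    · exact h.2

lemma exists_best_right (hfin : ∀ R : ℝ, {v | ‖v‖ ≤ R ∧ v ∈ Λ}.Finite) {a : ℝ}
    (h : ∃ v, IsCandidate Λ (a, 1) v) : ∃ v, IsBest {u | IsCandidate Λ (a, 1) u} v := by
  obtain ⟨u₀, hu₀⟩ := h
  have hval : ∀ u, IsCandidate Λ (a, 1) u →
      0 < (u.re / u.im - a) * u.im ∧ (u.re / u.im - a) * u.im ≤ 1 := by
    rintro u ⟨-, h1, h2, h3⟩
    have e := sub_eq_ratio h1 a 1
    rw [one_mul, one_mul] at e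
    simp only [one_mul, e] at h2 h3
    exact ⟨h2, h3⟩
  have hau : 0 < u₀.re / u₀.im - a := pos_of_mul_pos_left (hval u₀ hu₀).1 hu₀.2.1.le
  refine exists_isBest hu₀ ((finite_near hfin a (1 / (u₀.re / u₀.im - a)) 1).subset ?_)
  rintro u ⟨hu, hor⟩
  have h3 := hu.2.2.1
  have h4 := hu.2.2.2
  simp only [one_mul] at h3 h4
  refine ⟨hu.1, hu.2.1, ?_, by rw [abs_of_pos h3]; exact h4⟩
  have hle : u₀.re / u₀.im ≤ u.re / u.im := by
    rcases hor with h | h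
    · exact h.le
    · exact h.1.ge
  rw [le_div_iff₀ hau]
  have := mul_le_mul_of_nonneg_right (sub_le_sub_right hle a) hu.2.1.le
  linarith [(hval u hu).2]

/-- The winning vector at `(a, 1)` is the left winning vector immediately to the right of `a`. -/
lemma best_right_to_left (hfin : ∀ R : ℝ, {v | ‖v‖ ≤ R ∧ v ∈ Λ}.Finite) {a : ℝ} {v : ℂ}
    (h : IsBest {u | IsCandidate Λ (a, 1) u} v) :
    ∀ᶠ a' in 𝓝[>] a, IsBest {u | IsLeftCandidate Λ (a', 1) u} v := by
  obtain ⟨⟨hvΛ, hv0, hv1, hv2⟩, hbest⟩ := h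
  simp only [one_mul] at hv1 hv2
  have hρ : a < v.re / v.im := by rw [lt_div_iff₀ hv0]; linarith
  set c := (a + v.re / v.im) / 2 with hc
  set Y := 1 / (v.re / v.im - c)
  have hcv : 0 < v.re / v.im - c := by linarith
  -- A left candidate at `a' < c` with larger ratio than `v` has height at most `Y`. If it is not a
  -- candidate at `a`, its value there exceeds 1; finitely many such vectors occur, and their values
  -- stay above 1 for `a'` near `a`.
  have hF : ∀ᶠ a' in 𝓝[>] a, ∀ u ∈ {u | u ∈ Λ ∧ 0 < u.im ∧ u.im ≤ Y ∧
      |u.re - a * u.im| ≤ 1 + (c - a) * Y}, 1 < u.re - a * u.im → 1 < u.re - a' * u.im := by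
    refine (Filter.eventually_all_finite (finite_near hfin a Y _)).2 fun u _ => ?_
    by_cases hu : 1 < u.re - a * u.im
    · have : Tendsto (fun a' => u.re - a' * u.im) (𝓝[>] a) (𝓝 (u.re - a * u.im)) :=
        Continuous.continuousWithinAt (by fun_prop)
      filter_upwards [this.eventually (lt_mem_nhds hu)] with a' ha' _
      exact ha'
    · exact Filter.Eventually.of_forall fun a' h => absurd h hu
  have hac : a < c := by linarith
  filter_upwards [hF, Ioo_mem_nhdsGT hac] with a' hF ha'
  have hva : a' * v.im < v.re := by
    rw [← lt_div_iff₀ hv0]; linarith [ha'.2]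
  refine ⟨⟨hvΛ, hv0, by simp only [one_mul]; linarith, ?_⟩, ?_⟩
  · simp only [one_mul]
    have := mul_lt_mul_of_pos_right ha'.1 hv0
    linarith
  rintro u ⟨huΛ, hu0, hu1, hu2⟩
  have e : ∀ b, u.re - b * u.im = (u.re / u.im - b) * u.im := fun b => by
    have := sub_eq_ratio hu0 b 1
    simpa using this
  simp only [one_mul] at hu1 hu2
  rcases lt_trichotomy (u.re / u.im) (v.re / v.im) with hlt | heq | hgt
  · exact Or.inl hlt
  · refine Or.inr ⟨heq, ?_⟩
    by_contra! him
    have hcand : IsCandidate Λ (a, 1) u := by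
      refine ⟨huΛ, hu0, ?_, ?_⟩
      · simp only [one_mul]
        rw [e]; exact mul_pos (by rw [heq]; linarith) hu0
      · simp only [one_mul]
        have e' : v.re - a * v.im = (v.re / v.im - a) * v.im := by
          have := sub_eq_ratio hv0 a 1
          simpa using this
        rw [e, heq]
        have := mul_lt_mul_of_pos_left him (sub_pos.2 hρ)
        linarith
    rcases hbest u hcand with h | h
    · exact absurd heq h.ne
    · exact absurd h.2 (not_le.2 him)
  · exfalso
    have huY : u.im ≤ Y := by
      rw [le_div_iff₀ hcv]
      rw [e] at hu2
      have h1 : v.re / v.im - c ≤ u.re / u.im - a' := by linarith [ha'.2]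
      have := mul_le_mul_of_nonneg_right h1 hu0.le
      linarith
    have hpos : 0 < u.re - a * u.im := by
      rw [e]; exact mul_pos (by linarith) hu0
    have hY : 0 < Y := by positivity
    have hle : u.re - a * u.im ≤ 1 + (c - a) * Y := by
      have h1 : (a' - a) * u.im ≤ (c - a) * Y :=
        mul_le_mul (by linarith [ha'.2]) huY hu0.le (by linarith)
      linarith
    by_cases h1 : u.re - a * u.im ≤ 1
    · have hcand : IsCandidate Λ (a, 1) u :=
        ⟨huΛ, hu0, by simpa only [one_mul] using hpos, by simpa only [one_mul] using h1⟩
      rcases hbest u hcand with h | h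
      · exact absurd h (not_lt.2 hgt.le)
      · exact absurd h.1 hgt.ne'
    · have := hF u ⟨huΛ, hu0, huY, by rw [abs_of_pos hpos]; exact hle⟩ (not_le.1 h1)
      linarith

/-- A left winning vector remains the winner to the left as long as it is a candidate. -/
lemma best_left_mono {a a' : ℝ} {v : ℂ} (h : IsBest {u | IsLeftCandidate Λ (a, 1) u} v)
    (ha : a' ≤ a) (ha' : (v.re - 1) / v.im < a') :
    IsBest {u | IsLeftCandidate Λ (a', 1) u} v := by
  obtain ⟨⟨hvΛ, hv0, hv1, hv2⟩, hbest⟩ := h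
  simp only [one_mul] at hv1 hv2
  rw [div_lt_iff₀ hv0] at ha'
  have hm : a' * v.im ≤ a * v.im := mul_le_mul_of_nonneg_right ha hv0.le
  refine ⟨⟨hvΛ, hv0, by simp only [one_mul]; linarith, by simp only [one_mul]; linarith⟩, ?_⟩
  rintro u ⟨huΛ, hu0, hu1, hu2⟩
  simp only [one_mul] at hu1 hu2
  have hm' : a' * u.im ≤ a * u.im := mul_le_mul_of_nonneg_right ha hu0.le
  -- A vector that was not yet a candidate at `a` has ratio below `a`, hence below that of `v`.
  by_cases hc : 0 ≤ u.re - a * u.im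
  · exact hbest u ⟨huΛ, hu0, by simpa only [one_mul] using hc, by simp only [one_mul]; linarith⟩
  · left
    calc u.re / u.im < a := by rw [div_lt_iff₀ hu0]; linarith
      _ ≤ v.re / v.im := by rw [le_div_iff₀ hv0]; linarith

/-- The left winning vector at `(a, 1)` is the winning vector to the left of `a`. -/
lemma best_left_to_right {a a' : ℝ} {v : ℂ} (h : IsBest {u | IsLeftCandidate Λ (a, 1) u} v)
    (ha : a' < a) (ha' : (v.re - 1) / v.im < a') :
    IsBest {u | IsCandidate Λ (a', 1) u} v := by
  obtain ⟨⟨hvΛ, hv0, hv1, hv2⟩, hbest⟩ := h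
  simp only [one_mul] at hv1 hv2
  rw [div_lt_iff₀ hv0] at ha'
  have hm : a' * v.im < a * v.im := mul_lt_mul_of_pos_right ha hv0
  refine ⟨⟨hvΛ, hv0, by simp only [one_mul]; linarith, by simp only [one_mul]; linarith⟩, ?_⟩
  rintro u ⟨huΛ, hu0, hu1, hu2⟩
  simp only [one_mul] at hu1 hu2
  have hm' : a' * u.im < a * u.im := mul_lt_mul_of_pos_right ha hu0
  by_cases hc : 0 ≤ u.re - a * u.im
  · exact hbest u ⟨huΛ, hu0, by simpa only [one_mul] using hc, by simp only [one_mul]; linarith⟩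
  · left
    calc u.re / u.im < a := by rw [div_lt_iff₀ hu0]; linarith
      _ ≤ v.re / v.im := by rw [le_div_iff₀ hv0]; linarith

/-- A winning vector at `(a, b)` is also the winning vector where the line through `(a, b)` in its
own direction meets the line `b = 1`. -/
lemma best_top {a b : ℝ} {v : ℂ} (hb0 : 0 < b) (hb1 : b ≤ 1)
    (h : IsBest {u | IsCandidate Λ (a, b) u} v) :
    IsBest {u | IsCandidate Λ (a + (1 - b) / v.im * v.re, 1) u} v := by
  obtain ⟨⟨hvΛ, hv0, hv1, hv2⟩, hbest⟩ := h
  -- Sliding along `v` fixes its own value and does not lower that of any `u` with at least its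
  -- ratio, so such a candidate at the top was not above 1 at `(a, b)`.
  have hval : ∀ u : ℂ, 0 < u.im → 1 * u.re - (a + (1 - b) / v.im * v.re) * u.im =
      b * u.re - a * u.im + (1 - b) * u.im * (u.re / u.im - v.re / v.im) := by
    intro u hu
    field_simp
    ring
  simp only at hv1 hv2
  refine ⟨⟨hvΛ, hv0, ?_, ?_⟩, ?_⟩
  · simp only [hval v hv0]; simpa using hv1
  · simp only [hval v hv0]; simpa using hv2
  rintro u ⟨huΛ, hu0, hu1, hu2⟩
  simp only [hval u hu0] at hu1 hu2
  rcases lt_or_ge (u.re / u.im) (v.re / v.im) with hlt | hge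
  · exact Or.inl hlt
  refine hbest u ⟨huΛ, hu0, ?_, ?_⟩
  · rw [sub_eq_ratio hv0] at hv1
    simp only [sub_eq_ratio hu0]
    have h1 := pos_of_mul_pos_left hv1 hv0.le
    have h2 := mul_le_mul_of_nonneg_left hge hb0.le
    exact mul_pos (by linarith) hu0
  · have : 0 ≤ (1 - b) * u.im * (u.re / u.im - v.re / v.im) :=
      mul_nonneg (mul_nonneg (by linarith) hu0.le) (by linarith)
    simp only
    linarith

/-- To the right of the left end of `A^L`, left winning vectors are at least as good as the base
vector. -/
lemma left_end_le {z₀ : ℂ} (hz₀ : z₀ ∈ Λ) (hz₀' : 0 < z₀.im)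
    (hmin : ∀ v ∈ Λ, 0 < v.im → z₀.im ≤ v.im) {a : ℝ} (ha : (z₀.re - 1) / z₀.im < a) {v : ℂ}
    (h : IsBest {u | IsLeftCandidate Λ (a, 1) u} v) :
    (z₀.re - 1) / z₀.im ≤ (v.re - 1) / v.im ∧
      ((z₀.re - 1) / z₀.im = (v.re - 1) / v.im → v = z₀) := by
  obtain ⟨⟨hvΛ, hv0, hv1, hv2⟩, hbest⟩ := h
  simp only [one_mul] at hv1 hv2
  -- If the ratio of `v` were smaller, `z₀` would itself be a left candidate at `a` and beat `v`.
  have hratio : z₀.re / z₀.im ≤ v.re / v.im := by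
    by_contra! hlt
    have h1 : a ≤ v.re / v.im := by rw [le_div_iff₀ hv0]; linarith
    have h2 : a * z₀.im ≤ z₀.re := by rw [← le_div_iff₀ hz₀']; linarith
    rw [div_lt_iff₀ hz₀'] at ha
    rcases hbest z₀ ⟨hz₀, hz₀', by simp only [one_mul]; linarith, by simp only [one_mul]; linarith⟩
      with h | h <;> linarith
  have him := hmin v hvΛ hv0
  have hinv : 1 / v.im ≤ 1 / z₀.im := one_div_le_one_div_of_le hz₀' him
  rw [sub_div, sub_div]
  refine ⟨by linarith, fun e => ?_⟩
  have e1 : 1 / v.im = 1 / z₀.im := by linarith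
  have e2 : v.im = z₀.im := by
    have := one_div_one_div v.im
    rw [e1, one_div_one_div] at this
    exact this.symm
  have e3 : v.re / v.im = z₀.re / z₀.im := by linarith
  rw [e2] at e3
  exact Complex.ext ((div_left_inj' hz₀'.ne').1 e3) e2

/-- The winning vectors on the transversal are the left winning vectors on its top edge. -/
lemma mem_winners_iff (hfin : ∀ R : ℝ, {v | ‖v‖ ≤ R ∧ v ∈ Λ}.Finite) {z₀ : ℂ} {n : ℕ} {α : ℝ}
    (hz₀ : z₀ ∈ Λ) (hz₀' : 0 < z₀.im) (hmin : ∀ v ∈ Λ, 0 < v.im → z₀.im ≤ v.im) {v : ℂ} :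
    v ∈ winners Λ z₀ n α ↔
      ∃ a ∈ topEdgeL z₀ n α, IsBest {u | IsLeftCandidate Λ (a, 1) u} v := by
  constructor
  · rintro ⟨⟨a, b⟩, ⟨hb0, hb1, hl, hr⟩, hw⟩
    rw [isWinner_iff hb0] at hw
    simp only at hb0 hb1 hl hr
    have htop := best_top hb0 hb1 hw
    set a' := a + (1 - b) / v.im * v.re with ha'
    obtain ⟨⟨hvΛ, hv0, hv1, hv2⟩, hbest⟩ := hw
    simp only at hv1 hv2
    have ea' : a' = a + (1 - b) * (v.re / v.im) := by rw [ha']; ring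
    have hv1' : 0 < b * (v.re / v.im) - a := by
      rw [sub_eq_ratio hv0] at hv1
      exact pos_of_mul_pos_left hv1 hv0.le
    -- The left side of Ω says that `z₀` has value at most 1, so it would be a better candidate.
    have h0 : z₀.re / z₀.im ≤ v.re / v.im := by
      by_contra! hlt
      have h1 : 0 < b * (z₀.re / z₀.im) - a := by nlinarith
      have h2 : (b * (z₀.re / z₀.im) - a) * z₀.im ≤ 1 := by
        rw [← le_div_iff₀ hz₀']; linarith
      rcases hbest z₀ ⟨hz₀, hz₀', by simp only [sub_eq_ratio hz₀']; positivity,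
        by simpa only [sub_eq_ratio hz₀'] using h2⟩ with h | h <;> linarith
    -- Beyond the right side of Ω the value of `v` would exceed v.im / z₀.im ≥ 1.
    have h1 : v.re / v.im < z₀.re / z₀.im + n * α := by
      by_contra! hle
      have h1 : 1 / z₀.im < b * (v.re / v.im) - a := by nlinarith
      have h2 : 1 / v.im ≤ 1 / z₀.im := one_div_le_one_div_of_le hz₀' (hmin v hvΛ hv0)
      have h3 : 1 / v.im < b * (v.re / v.im) - a := by linarith
      rw [div_lt_iff₀ hv0, ← sub_eq_ratio hv0] at h3
      linarith
    have hlow : (z₀.re - 1) / z₀.im ≤ a' := by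
      rw [ea', sub_div]; nlinarith
    have hhigh : a' < rightEnd z₀ n α := by
      rw [ea', rightEnd, sub_div]; nlinarith
    -- `a'` may be the excluded left end of A^L; a small move to the right enters the interval and
    -- turns the winner into a left winner.
    obtain ⟨c, hc1, hc2⟩ :=
      ((best_right_to_left hfin htop).and (Ioo_mem_nhdsGT hhigh)).exists
    exact ⟨c, ⟨hlow.trans_lt hc2.1, hc2.2.le⟩, hc1⟩
  · rintro ⟨a, ⟨ha1, ha2⟩, h⟩
    have hva : (v.re - 1) / v.im < a := by
      have h1 := h.1.2.2.2
      simp only [one_mul] at h1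
      rw [div_lt_iff₀ h.1.2.1]; linarith
    have hle := (left_end_le hz₀ hz₀' hmin ha1 h).1
    rw [rightEnd, sub_div] at ha2
    rw [sub_div z₀.re] at hle
    -- Any point strictly between the left end of the interval of `v` and `a` would do.
    refine ⟨(((v.re - 1) / v.im + a) / 2, 1), ⟨one_pos, le_rfl, ?_, ?_⟩, ?_⟩
    · simp only [mul_one]; linarith
    · simp only [mul_one]; linarith
    · rw [isWinner_iff (by exact one_pos)]
      exact best_left_to_right h (by linarith) (by linarith)

/-- Correctness of the algorithm for a locally finite set of vectors that has candidates at all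
points of the top edge. -/
theorem algorithm_correct (hfin : ∀ R : ℝ, {v | ‖v‖ ≤ R ∧ v ∈ Λ}.Finite) {z₀ : ℂ} {n : ℕ} {α : ℝ}
    (hα : 0 < n * α) (hz₀ : z₀ ∈ Λ) (hz₀' : 0 < z₀.im)
    (hmin : ∀ v ∈ Λ, 0 < v.im → z₀.im ≤ v.im)
    (hleft : ∀ a, ∃ v, IsLeftCandidate Λ (a, 1) v) (hright : ∀ a, ∃ v, IsCandidate Λ (a, 1) v)
    (find : ℝ → ℂ) (a : ℕ → ℝ) (ha : a = algPoint find (rightEnd z₀ n α))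
    (uv : ℕ → ℂ) (huv : uv = algVector find (rightEnd z₀ n α))
    (hfind : ∀ i, Reached find (rightEnd z₀ n α) z₀ i →
      (∃ v, IsLeftWinner Λ (a i, 1) v) → IsLeftWinner Λ (a i, 1) (uv i)) :
    ∃ N : ℕ, EndsAt find (rightEnd z₀ n α) z₀ N ∧
      (∀ i ≤ N, a i ∈ topEdgeL z₀ n α ∧ IsLeftWinner Λ (a i, 1) (uv i)) ∧
      {v | ∃ i ≤ N, uv i = v} = winners Λ z₀ n α ∧
      ∀ i ≤ N, leftWinSet Λ z₀ n α (uv i) = Set.Ioc (a (i + 1)) (a i) := by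
  have ha0 : a 0 = rightEnd z₀ n α := by rw [ha]; rfl
  have hsucc : ∀ i, a (i + 1) = ((uv i).re - 1) / (uv i).im := fun i => by rw [ha, huv]; rfl
  have hpos : ∀ a, ∀ u ∈ {u | IsLeftCandidate Λ (a, 1) u}, 0 < u.im := fun a u hu => hu.2.1
  -- the state of the algorithm in a round that is reached
  have hstep : ∀ i, a i ∈ topEdgeL z₀ n α → Reached find (rightEnd z₀ n α) z₀ i →
      IsBest {u | IsLeftCandidate Λ (a i, 1) u} (uv i) := fun i hi hr => by
    obtain ⟨v, hv⟩ := exists_best_left hfin (hleft (a i))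
    exact isLeftWinner_iff.1 (hfind i hr ⟨v, isLeftWinner_iff.2 hv⟩)
  have hdecr : ∀ i, IsBest {u | IsLeftCandidate Λ (a i, 1) u} (uv i) → a (i + 1) < a i :=
    fun i h => by
      have h1 := h.1.2.2.2
      simp only [one_mul] at h1
      rw [hsucc, div_lt_iff₀ h.1.2.1]; linarith
  have hreach : ∀ i, Reached find (rightEnd z₀ n α) z₀ i → a i ∈ topEdgeL z₀ n α := by
    intro i
    induction i with
    | zero =>
      intro _
      rw [ha0]
      exact ⟨by rw [rightEnd]; linarith, le_rfl⟩
    | succ i ih =>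
      intro hr
      have hr' : Reached find (rightEnd z₀ n α) z₀ i := fun j hj => hr j (by omega)
      have hi := ih hr'
      have hb := hstep i hi hr'
      have hne : uv i ≠ z₀ := by rw [huv]; exact hr i (by omega)
      have hle := left_end_le hz₀ hz₀' hmin hi.1 hb
      refine ⟨?_, (hdecr i hb).le.trans hi.2⟩
      rw [hsucc]
      exact hle.1.lt_of_ne fun e => hne (hle.2 e)
  have hbest : ∀ i, Reached find (rightEnd z₀ n α) z₀ i →
      IsBest {u | IsLeftCandidate Λ (a i, 1) u} (uv i) := fun i hr => hstep i (hreach i hr) hr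
  -- termination
  have hterm : ∃ N, uv N = z₀ := by
    by_contra! hne
    have hall : ∀ i, Reached find (rightEnd z₀ n α) z₀ i := fun i j _ => by
      have := hne j; rwa [huv] at this
    have hanti : StrictAnti a := strictAnti_nat_of_succ_lt fun i => hdecr i (hbest i (hall i))
    have hbdd : BddBelow (range a) := ⟨(z₀.re - 1) / z₀.im, by
      rintro _ ⟨i, rfl⟩
      exact (hreach i (hall i)).1.le⟩
    have hlim := tendsto_atTop_ciInf hanti.antitone hbdd
    set l := ⨅ i, a i
    have hl : ∀ i, l < a i := fun i => (ciInf_le hbdd (i + 1)).trans_lt (hanti (Nat.lt_succ_self i))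
    -- This `v` is the left winner at some `a i` close to the limit, so `uv i = v`. Its value at `l`
    -- is at most 1, that is, `a (i + 1) ≤ l`.
    obtain ⟨v, hv⟩ := exists_best_right hfin (hright l)
    have hlim' : Tendsto a atTop (𝓝[>] l) :=
      tendsto_nhdsWithin_iff.2 ⟨hlim, Filter.Eventually.of_forall hl⟩
    obtain ⟨i, hi⟩ := (hlim'.eventually (best_right_to_left hfin hv)).exists
    have e := (hbest i (hall i)).unique (hpos _) hi
    have h1 := hv.1.2.2.2
    simp only [one_mul] at h1
    have h2 := hl (i + 1)
    rw [hsucc, e, lt_div_iff₀ hv.1.2.1] at h2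
    linarith
  classical
  set N := Nat.find hterm
  have hN : uv N = z₀ := Nat.find_spec hterm
  have hrN : ∀ i ≤ N, Reached find (rightEnd z₀ n α) z₀ i := fun i hi j hj => by
    have := Nat.find_min hterm (hj.trans_le hi)
    rwa [huv] at this
  have hb : ∀ i ≤ N, IsBest {u | IsLeftCandidate Λ (a i, 1) u} (uv i) := fun i hi =>
    hbest i (hrN i hi)
  have hmem : ∀ i ≤ N, a i ∈ topEdgeL z₀ n α := fun i hi => hreach i (hrN i hi)
  have hend : a (N + 1) = (z₀.re - 1) / z₀.im := by rw [hsucc, hN]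
  have hsub : ∀ i ≤ N, ∀ c ∈ Ioc (a (i + 1)) (a i),
      IsBest {u | IsLeftCandidate Λ (c, 1) u} (uv i) := fun i hi c hc =>
    best_left_mono (hb i hi) hc.2 (by rw [← hsucc]; exact hc.1)
  -- Consecutive intervals share endpoints, and the last one ends at the left end of A^L.
  have hcover : ∀ c ∈ topEdgeL z₀ n α, ∃ j ≤ N, c ∈ Ioc (a (j + 1)) (a j) := by
    intro c hc
    have hex : ∃ j, a (j + 1) < c := ⟨N, by rw [hend]; exact hc.1⟩
    refine ⟨Nat.find hex, Nat.find_min' hex (by rw [hend]; exact hc.1), Nat.find_spec hex, ?_⟩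
    rcases h : Nat.find hex with _ | k
    · rw [ha0]; exact hc.2
    · exact not_lt.1 (Nat.find_min hex (m := k) (by omega))
  have hlt : ∀ i j, i < j → j ≤ N + 1 → a j < a i := by
    intro i j hij
    induction j, hij using Nat.le_induction with
    | base => exact fun h => hdecr i (hb i (by omega))
    | succ j hij ih => exact fun h => (hdecr j (hb j (by omega))).trans (ih (by omega))
  refine ⟨N, ⟨hrN N le_rfl, by rw [← huv]; exact hN⟩,
    fun i hi => ⟨hmem i hi, isLeftWinner_iff.2 (hb i hi)⟩, ?_, ?_⟩
  · ext v
    rw [mem_winners_iff hfin hz₀ hz₀' hmin]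
    constructor
    · rintro ⟨i, hi, rfl⟩
      exact ⟨a i, hmem i hi, hb i hi⟩
    · rintro ⟨c, hc, hv⟩
      obtain ⟨j, hj, hcj⟩ := hcover c hc
      exact ⟨j, hj, (hsub j hj c hcj).unique (hpos _) hv⟩
  · intro i hi
    ext c
    constructor
    · rintro ⟨hc, hw⟩
      obtain ⟨j, hj, hcj⟩ := hcover c hc
      have e := (hsub j hj c hcj).unique (hpos _) (isLeftWinner_iff.1 hw)
      -- The vector determines the next point, and the points strictly decrease up to index `N + 1`;
      -- so no vector is found twice.
      have e' : a (j + 1) = a (i + 1) := by rw [hsucc, hsucc, e]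
      rcases lt_trichotomy i j with h | h | h
      · exact absurd e' (hlt (i + 1) (j + 1) (by omega) (by omega)).ne
      · exact h ▸ hcj
      · exact absurd e' (hlt (j + 1) (i + 1) (by omega) (by omega)).ne'
    · intro hc
      refine ⟨⟨?_, hc.2.trans (hmem i hi).2⟩, isLeftWinner_iff.2 (hsub i hi c hc)⟩
      refine lt_of_le_of_lt ?_ hc.1
      rw [hsucc]
      exact (left_end_le hz₀ hz₀' hmin (hmem i hi).1 (hb i hi)).1

end Order

end Slopes

/-! ### Transfer to the normalized surface. -/

namespace Slopes

lemma planeMap_inv_planeMap (C : SL(2, ℝ)) (v : ℂ) :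
    planeMap (C⁻¹ : SL(2, ℝ)) (planeMap C v) = v := by
  rw [← planeMap_mul, inv_mul_cancel, planeMap_one]

lemma planeMap_planeMap_inv (C : SL(2, ℝ)) (v : ℂ) :
    planeMap C (planeMap (C⁻¹ : SL(2, ℝ)) v) = v := by
  rw [← planeMap_mul, mul_inv_cancel, planeMap_one]

lemma planeMap_add_mul (A : Matrix (Fin 2) (Fin 2) ℝ) (x t : ℝ) (u v : ℂ) :
    planeMap A ((x : ℂ) * u + (t : ℂ) * v) = (x : ℂ) * planeMap A u + (t : ℂ) * planeMap A v := by
  apply Complex.ext <;>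
    simp only [planeMap, Complex.add_re, Complex.add_im, Complex.re_ofReal_mul,
      Complex.im_ofReal_mul] <;> ring

lemma cross_planeMap (A : SL(2, ℝ)) (u v : ℂ) :
    cross (planeMap A u) (planeMap A v) = cross u v := by
  have h := A.det_coe
  rw [Matrix.det_fin_two] at h
  simp only [cross, planeMap]
  linear_combination (u.re * v.im - u.im * v.re) * h

section Cusp

variable {X : Type*} [TopologicalSpace X] {S : TranslationSurface X} {H : Subgroup SL(2, ℝ)}
  {P C : SL(2, ℝ)} {w : ℂ} {α : ℝ} {n : ℕ}

/-- In the normalized surface there are candidates at all points of the line `b = 1`. -/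
lemma IsCuspNormalization.exists_candidates [T2Space X] [CompactSpace X]
    (hC : IsCuspNormalization S H P C w α n) (a : ℝ) :
    (∃ v, IsLeftCandidate (planeMap C '' S.holonomy) (a, 1) v) ∧
      ∃ v, IsCandidate (planeMap C '' S.holonomy) (a, 1) v := by
  -- In the basis `w`, `d` the coefficient of `w` is the value at `(a, 1)` that defines candidates,
  -- and the coefficient of `d` is the height.
  set d : ℂ := planeMap (C⁻¹ : SL(2, ℝ)) ⟨a, 1⟩ with hd
  have hCd : planeMap C d = ⟨a, 1⟩ := planeMap_planeMap_inv C _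
  have hwd : cross w d ≠ 0 := by
    rw [← cross_planeMap C, hC.normalized, hCd]
    simp [cross]
  have hmap : ∀ x t : ℝ, planeMap C ((x : ℂ) * w + (t : ℂ) * d) = ⟨x + t * a, t⟩ := by
    intro x t
    rw [planeMap_add_mul, hC.normalized, hCd]
    apply Complex.ext <;> simp
  obtain ⟨⟨x, t, h1, h2, h3, h4⟩, ⟨x', t', h1', h2', h3', h4'⟩⟩ :=
    TranslationSurface.exists_holonomy_in_strip hC.mem hwd
  refine ⟨⟨_, ⟨_, h4, hmap x t⟩, h3, ?_, ?_⟩, ⟨_, ⟨_, h4', hmap x' t'⟩, h3', ?_, ?_⟩⟩ <;>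
    simp only <;> linarith

lemma finite_planeMap_image [T2Space X] [CompactSpace X] (S : TranslationSurface X) (C : SL(2, ℝ))
    (R : ℝ) : {v | ‖v‖ ≤ R ∧ v ∈ planeMap C '' S.holonomy}.Finite := by
  have hbd : ∃ M : ℝ, ∀ v : ℂ, ‖v‖ ≤ R → ‖planeMap (C⁻¹ : SL(2, ℝ)) v‖ ≤ M := by
    have hcont : Continuous (planeMap (C⁻¹ : SL(2, ℝ))) := by
      have : planeMap (C⁻¹ : SL(2, ℝ)) = fun z : ℂ =>
          (((C⁻¹ : SL(2, ℝ)) 0 0 * z.re + (C⁻¹ : SL(2, ℝ)) 0 1 * z.im : ℝ) : ℂ) +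
          (((C⁻¹ : SL(2, ℝ)) 1 0 * z.re + (C⁻¹ : SL(2, ℝ)) 1 1 * z.im : ℝ) : ℂ) * Complex.I := by
        funext z
        exact (Complex.mk_eq_add_mul_I _ _)
      rw [this]
      fun_prop
    obtain ⟨M, hM⟩ := ((isCompact_closedBall (0 : ℂ) R).image hcont).isBounded.exists_norm_le
    exact ⟨M, fun v hv => hM _ ⟨v, by simpa using hv, rfl⟩⟩
  obtain ⟨M, hM⟩ := hbd
  refine ((S.finite_holonomy M).image (planeMap C)).subset ?_
  rintro _ ⟨hv, u, hu, rfl⟩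
  refine ⟨u, ⟨?_, hu⟩, rfl⟩
  have := hM _ hv
  rwa [planeMap_inv_planeMap] at this

end Cusp

end Slopes

theorem mainTheorem2 {X : Type*} [TopologicalSpace X] [T2Space X] [CompactSpace X]
    [ConnectedSpace X] (S : Slopes.TranslationSurface X) (hS : S.IsVeech)
    (H : Subgroup (Matrix.SpecialLinearGroup (Fin 2) ℝ))
    (P C : Matrix.SpecialLinearGroup (Fin 2) ℝ) (w : ℂ) (α : ℝ) (n : ℕ)
    (hC : Slopes.IsCuspNormalization S H P C w α n)
    (Λ : Set ℂ) (hΛ : Λ = Slopes.planeMap C '' S.holonomy)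
    (z₀ : ℂ) (hz₀ : Slopes.IsBaseVector Λ z₀)
    (find : ℝ → ℂ) (a : ℕ → ℝ) (ha : a = Slopes.algPoint find (Slopes.rightEnd z₀ n α))
    (uv : ℕ → ℂ) (huv : uv = Slopes.algVector find (Slopes.rightEnd z₀ n α))
    (hfind : ∀ i, Slopes.Reached find (Slopes.rightEnd z₀ n α) z₀ i →
      (∃ v, Slopes.IsLeftWinner Λ (a i, 1) v) → Slopes.IsLeftWinner Λ (a i, 1) (uv i)) :
    ∃ N : ℕ, Slopes.EndsAt find (Slopes.rightEnd z₀ n α) z₀ N ∧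
      (∀ i ≤ N, a i ∈ Slopes.topEdgeL z₀ n α ∧ Slopes.IsLeftWinner Λ (a i, 1) (uv i)) ∧
      {v | ∃ i ≤ N, uv i = v} = Slopes.winners Λ z₀ n α ∧
      ∀ i ≤ N, Slopes.leftWinSet Λ z₀ n α (uv i) = Set.Ioc (a (i + 1)) (a i) := by

  subst hΛ
  have hn : 0 < (n : ℝ) := by
    rcases hC.conj with ⟨rfl, -⟩ | ⟨rfl, -⟩ <;> norm_num
  exact Slopes.algorithm_correct (Slopes.finite_planeMap_image S C) (mul_pos hn hC.pos) hz₀.1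
    hz₀.2.1.1.1 (fun v hv hv0 => hz₀.2.1.2 ⟨hv0, v, hv, rfl⟩)
    (fun a => (hC.exists_candidates a).1) (fun a => (hC.exists_candidates a).2) find a ha uv huv
    hfind
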